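/- Lemma. Let $k\ge 3$ and $0\le\alpha<1$. For a $k$-uniform hypergraph $G=(V,E)$ ($V$ finite, $E$ a set of $k$-subsets of $V$) let $\mathcal A(G)$ be the tensor of order $k$ indexed by $V$ whose entry at $(i_1,\dots,i_k)$ is $\frac1{(k-1)!}$ if $\{i_1,\dots,i_k\}\in E$ and $0$ otherwise, let $\mathcal D(G)$ be the diagonal tensor of order $k$ with diagonal entries the vertex degrees, and let $\rho_\alpha(G)$ be the spectral radius of $\mathcal A_\alpha(G)=\alpha\mathcal D(G)+(1-\alpha)\mathcal A(G)$, i.e. the largest modulus of a number $\lambda\in\mathbb C$ for which some nonzero $x\in\mathbb C^V$ satisfies $\sum_{i_2,\dots,i_k}\mathcal A_\alpha(G)_{v i_2\cdots i_k}x_{i_2}\cdots x_{i_k}=\lambda x_v^{k-1}$ for all $v\in V$. A supertree is a connected hypergraph without cycles, where a cycle is $v_1e_1v_2e_2\cdots v_le_lv_1$ with $l\ge 2$, distinct vertices $v_i$, distinct edges $e_i$, $v_i,v_{i+1}\in e_i$ for $i<l$ and $v_l,v_1\in e_l$. The distance between two vertices is the least number of edges of a path joining them. An edge is pendant if all of its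 vertices, except at most one, have degree one. A supertree is a caterpillar if the edges that are not pendant form a loose path, i.e. can be listed as distinct edges $e_1,\dots,e_l$ ($l\ge 0$) with $|e_i\cap e_j|=1$ if $|i-j|=1$ and $e_i\cap e_j=\varnothing$ if $|i-j|\ge2$; otherwise it is a non-caterpillar. Let $C(m,d)$ and $NC(m,d)$ be the sets of $k$-uniform caterpillars and of $k$-uniform non-caterpillars, respectively, with $m$ edges and diameter $d$. Then for every $G\in NC(m,d)$ there exists $G'\in C(m,d)$, on the same vertex set, with $\rho_\alpha(G')>\rho_\alpha(G)$. -/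

import Mathlib

noncomputable section

namespace AlphaSpectral

/-! ### Tensors and their eigenvalues -/

/-- A real tensor of order `k` whose indices range over `V` (so of dimension `|V|`). -/
abbrev Tensor (k : ℕ) (V : Type*) : Type _ := (Fin k → V) → ℝ

section Tensor

variable {V : Type*} [Fintype V] {k : ℕ}

open scoped Classical in
/-- The vector `A x`, with `(A x)_v = ∑ a_{v i₂ ⋯ iₖ} x_{i₂} ⋯ x_{iₖ}`: the sum runs over all
multi-indices `i` whose first entry is `v`. -/
def Tensor.apply (A : Tensor k V) (x : V → ℂ) (v : V) : ℂ :=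
  ∑ i : Fin k → V with ∀ j : Fin k, (j : ℕ) = 0 → i j = v,
    (A i : ℂ) * ∏ j ∈ Finset.univ.filter (fun j : Fin k => (j : ℕ) ≠ 0), x (i j)

/-- `μ ∈ ℂ` is an eigenvalue of `A` if `A x = μ x^{[k-1]}` for some nonzero `x ∈ ℂ^V`. -/
def Tensor.IsEigenvalue (A : Tensor k V) (μ : ℂ) : Prop :=
  ∃ x : V → ℂ, x ≠ 0 ∧ ∀ v, A.apply x v = μ * x v ^ (k - 1)

/-- The spectral radius: the largest modulus of an eigenvalue. -/
def Tensor.spectralRadius (A : Tensor k V) : ℝ :=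
  sSup {r : ℝ | ∃ μ : ℂ, A.IsEigenvalue μ ∧ r = ‖μ‖}

end Tensor

/-! ### Hypergraphs -/

section Hypergraph

variable {V : Type*}

/-- `G` is a `k`-uniform hypergraph whose vertex set is the whole type `V`. -/
def IsUniform (k : ℕ) (G : Hypergraph V) : Prop :=
  G.vertexSet = Set.univ ∧ ∀ e ∈ G.edgeSet, e.ncard = k

/-- The degree of a vertex: the number of edges containing it. -/
def degree (G : Hypergraph V) (v : V) : ℕ := {e | e ∈ G.edgeSet ∧ v ∈ e}.ncard

/-- The graph on `V` joining two distinct vertices that lie in a common edge. A path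
`v₀ e₁ v₁ ⋯ e_l v_l` of the hypergraph gives a path of length `l` in this graph and conversely,
so connectedness, distance and diameter of the hypergraph are those of this graph. -/
def adjGraph (G : Hypergraph V) : SimpleGraph V := SimpleGraph.fromRel G.Adj

/-- `G` contains a cycle `v₁ e₁ v₂ e₂ ⋯ v_l e_l v₁` with `l ≥ 2`, distinct vertices and
distinct edges (the indices are cyclic). -/
def HasCycle (G : Hypergraph V) : Prop :=
  ∃ (l : ℕ) (v : Fin (l + 2) → V) (e : Fin (l + 2) → Set V),
    Function.Injective v ∧ Function.Injective e ∧
      ∀ i, e i ∈ G.edgeSet ∧ v i ∈ e i ∧ v (i + 1) ∈ e i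

/-- A supertree: a connected and acyclic hypergraph. -/
def IsSupertree (G : Hypergraph V) : Prop := (adjGraph G).Connected ∧ ¬ HasCycle G

/-- A pendant edge: all its vertices, except at most one, have degree one. -/
def IsPendantEdge (G : Hypergraph V) (e : Set V) : Prop :=
  e ∈ G.edgeSet ∧ {v | v ∈ e ∧ degree G v ≠ 1}.Subsingleton

/-- The edges in `S` form a loose path: they can be listed as distinct `e₁, …, e_l` so that
consecutive ones share exactly one vertex and others are disjoint. The case `l = 0`
(no edge, a path consisting of a single vertex) is included. -/
def IsLoosePath (S : Set (Set V)) : Prop :=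
  ∃ (l : ℕ) (e : Fin l → Set V), Function.Injective e ∧ Set.range e = S ∧
    ∀ i j : Fin l, i < j → (e i ∩ e j).encard = if (i : ℕ) + 1 = j then 1 else 0

/-- A caterpillar: a supertree in which the removal of all pendant edges results in a
loose path. -/
def IsCaterpillar (G : Hypergraph V) : Prop :=
  IsSupertree G ∧ IsLoosePath {e | e ∈ G.edgeSet ∧ ¬ IsPendantEdge G e}

/-- A non-caterpillar: a supertree that is not a caterpillar. -/
def IsNonCaterpillar (G : Hypergraph V) : Prop := IsSupertree G ∧ ¬ IsCaterpillar G

/-- The class `C(m, d)` on the vertex set `V`: `k`-uniform caterpillars with `m` edges and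
diameter `d`. -/
def caterpillars (V : Type*) (k m d : ℕ) : Set (Hypergraph V) :=
  {G | IsUniform k G ∧ IsCaterpillar G ∧ G.edgeSet.ncard = m ∧ (adjGraph G).diam = d}

/-- The class `NC(m, d)` on the vertex set `V`: `k`-uniform non-caterpillars with `m` edges and
diameter `d`. -/
def nonCaterpillars (V : Type*) (k m d : ℕ) : Set (Hypergraph V) :=
  {G | IsUniform k G ∧ IsNonCaterpillar G ∧ G.edgeSet.ncard = m ∧ (adjGraph G).diam = d}

end Hypergraph

/-! ### The tensor `𝒜_α` of a uniform hypergraph -/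

section AlphaTensor

variable {V : Type*} [Fintype V]

open scoped Classical in
/-- The adjacency tensor: the entry at `(i₁, …, iₖ)` is `1 / (k-1)!` if `{i₁, …, iₖ}` is an edge
and `0` otherwise. -/
def adjacencyTensor (k : ℕ) (G : Hypergraph V) : Tensor k V :=
  fun i => if Set.range i ∈ G.edgeSet then 1 / ((k - 1).factorial : ℝ) else 0

open scoped Classical in
/-- The degree tensor: diagonal, with entry `deg v` at `(v, …, v)`. -/
def degreeTensor (k : ℕ) (G : Hypergraph V) : Tensor k V :=
  fun i => ∑ v : V, if i = (fun _ => v) then (degree G v : ℝ) else 0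

/-- `𝒜_α(G) = α 𝒟(G) + (1 - α) 𝒜(G)`. -/
def alphaTensor (k : ℕ) (α : ℝ) (G : Hypergraph V) : Tensor k V :=
  fun i => α * degreeTensor k G i + (1 - α) * adjacencyTensor k G i

/-- The `α`-spectral radius `ρ_α(G)` of a `k`-uniform hypergraph `G`. -/
def alphaSpectralRadius (k : ℕ) (α : ℝ) (G : Hypergraph V) : ℝ :=
  (alphaTensor k α G).spectralRadius

end AlphaTensor

end AlphaSpectral

end

/-!
Let `G` be a supertree and let `u`, `w` be two vertices of an edge `f`, both of degree at least two.
The *shift* from `u` to `w` replaces `u` by `w` in every edge that contains `u` but not `w`, so that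
all branches at `u` now hang at `w`. It has two properties.

* It strictly increases the spectral radius (`alphaSpectralRadius_lt_shift`). For a connected
  uniform hypergraph the spectral radius is the maximum of the form `∑_v x_v (𝒜_α x)_v` over the
  nonnegative vectors with `∑ x_v ^ k = 1`; a maximizer is positive and is an eigenvector
  (`exists_perron_vector`). If the maximizer `x` for `G` satisfies `x u ≤ x w`, the shift does not
  decrease the value of the form at `x`, and equality would contradict the eigenvalue equation
  at `w`, where new edges appear. If `x w ≤ x u`, the same applies to the shift from `w` to `u`,
  which is the same hypergraph with the names of `u` and `w` exchanged.
* It gives a supertree again, and it keeps the diameter if some diametral path avoids the branches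
  at `u` (`not_hasCycle_shift`, `connected_shift`, `diam_shift`). Acyclicity is handled through
  *gate maps*: a hypergraph is acyclic iff each edge `e` has a map on the vertices that is injective
  on `e` and constant on every other edge. Distances are compared by maps that send edges to single
  vertices or into edges.

If `G` is not a caterpillar, such `f`, `u`, `w` exist (`IsNonCaterpillar.exists_branch`): otherwise,
for `a`, `b` at maximal distance, every edge that is not pendant would separate `a` from `b`, hence
lie on a geodesic from `a` to `b`, and the edges that are not pendant would form a loose path.

So a supertree of largest spectral radius among the finitely many uniform ones with given number of
edges and diameter is a caterpillar, and a non-caterpillar does not attain this maximum.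
-/

noncomputable section

namespace AlphaSpectral

section Combinatorics

variable {V : Type*}

/-! ### Distances and geodesics -/

/-- A function on the vertices that grows by at most one along each edge of a graph grows by at
most `dist x y` from `x` to `y`. -/
lemma _root_.SimpleGraph.Reachable.le_add_dist {H : SimpleGraph V} {ℓ : V → ℕ}
    (h : ∀ x y, H.Adj x y → ℓ y ≤ ℓ x + 1) {x y : V} (hxy : H.Reachable x y) :
    ℓ y ≤ ℓ x + H.dist x y := by
  obtain ⟨p, hp⟩ := hxy.exists_walk_length_eq_dist
  rw [← hp]
  clear hp hxy
  induction p with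
  | nil => simp
  | cons hadj p ih =>
    have := h _ _ hadj
    rw [SimpleGraph.Walk.length_cons]
    omega

lemma _root_.SimpleGraph.Reachable.exists_geodesic {H : SimpleGraph V} {a b : V}
    (hab : H.Reachable a b) :
    ∃ p : ℕ → V, p 0 = a ∧ p (H.dist a b) = b ∧ (∀ i < H.dist a b, H.Adj (p i) (p (i + 1))) ∧
      ∀ i j, i ≤ j → j ≤ H.dist a b → H.dist (p i) (p j) = j - i := by
  obtain ⟨q, hq⟩ := hab.exists_walk_length_eq_dist
  have hadj : ∀ i < H.dist a b, H.Adj (q.getVert i) (q.getVert (i + 1)) :=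
    fun i hi => q.adj_getVert_succ (hq ▸ hi)
  have key : ∀ i n, i + n ≤ H.dist a b → H.Reachable (q.getVert i) (q.getVert (i + n)) ∧
      H.dist (q.getVert i) (q.getVert (i + n)) ≤ n := by
    intro i n
    induction n with
    | zero => intro _; simp
    | succ n ih =>
      intro hn
      obtain ⟨h1, h2⟩ := ih (by omega)
      have h3 := hadj (i + n) (by omega)
      refine ⟨h1.trans h3.reachable, ?_⟩
      have h4 := h1.dist_triangle_left (q.getVert (i + (n + 1)))
      have h5 : H.dist (q.getVert (i + n)) (q.getVert (i + (n + 1))) = 1 :=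
        SimpleGraph.dist_eq_one_iff_adj.2 h3
      omega
  refine ⟨q.getVert, q.getVert_zero, by rw [← hq]; exact q.getVert_length, hadj, ?_⟩
  intro i j hij hj
  obtain ⟨n, rfl⟩ := Nat.exists_eq_add_of_le hij
  obtain ⟨r1, d1⟩ := key 0 i (by omega)
  obtain ⟨r2, d2⟩ := key i n hj
  obtain ⟨r3, d3⟩ := key (i + n) (H.dist a b - (i + n)) (by omega)
  have e1 : i + n + (H.dist a b - (i + n)) = q.length := by omega
  rw [zero_add, q.getVert_zero] at r1 d1
  rw [e1, q.getVert_length] at r3 d3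
  have t1 := r1.dist_triangle_left b
  have t2 := r2.dist_triangle_left b
  omega

lemma adjGraph_adj {G : Hypergraph V} {x y : V} :
    (adjGraph G).Adj x y ↔ x ≠ y ∧ ∃ e ∈ G.edgeSet, x ∈ e ∧ y ∈ e := by
  unfold adjGraph Hypergraph.Adj
  rw [SimpleGraph.fromRel_adj]
  constructor
  · rintro ⟨h, ⟨e, he, h1, h2⟩ | ⟨e, he, h1, h2⟩⟩
    exacts [⟨h, e, he, h1, h2⟩, ⟨h, e, he, h2, h1⟩]
  · rintro ⟨h, e, he, h1, h2⟩
    exact ⟨h, Or.inl ⟨e, he, h1, h2⟩⟩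

lemma dist_le_one_of_mem {G : Hypergraph V} {e : Set V} (he : e ∈ G.edgeSet) {x y : V}
    (hx : x ∈ e) (hy : y ∈ e) : (adjGraph G).dist x y ≤ 1 := by
  by_cases h : x = y
  · subst h; simp
  · exact (SimpleGraph.dist_eq_one_iff_adj.2 (adjGraph_adj.2 ⟨h, e, he, hx, hy⟩)).le

/-- `c` maps each edge of `G` to a single vertex or into an edge of `G'`. -/
def IsContraction (G G' : Hypergraph V) (c : V → V) : Prop :=
  ∀ e ∈ G.edgeSet, ∀ x ∈ e, ∀ y ∈ e, c x = c y ∨ ∃ e' ∈ G'.edgeSet, c x ∈ e' ∧ c y ∈ e'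

lemma IsContraction.reachable {G G' : Hypergraph V} {c : V → V} (hc : IsContraction G G' c)
    {x y : V} (h : (adjGraph G).Reachable x y) : (adjGraph G').Reachable (c x) (c y) := by
  obtain ⟨p⟩ := h
  induction p with
  | nil => exact .refl _
  | @cons x y z hadj p ih =>
    refine SimpleGraph.Reachable.trans ?_ ih
    obtain ⟨-, e, he, h1, h2⟩ := adjGraph_adj.1 hadj
    by_cases hxy : c x = c y
    · rw [hxy]
    · obtain h | h := hc e he x h1 y h2
      · exact absurd h hxy
      · exact (adjGraph_adj.2 ⟨hxy, h⟩).reachable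

lemma IsContraction.dist_le {G G' : Hypergraph V} {c : V → V} (hc : IsContraction G G' c)
    {x y : V} (h : (adjGraph G).Connected) :
    (adjGraph G').dist (c x) (c y) ≤ (adjGraph G).dist x y := by
  have := (h x y).le_add_dist (ℓ := fun z => (adjGraph G').dist (c x) (c z)) ?_
  · simpa using this
  · intro z t hzt
    obtain ⟨-, e, he, h1, h2⟩ := adjGraph_adj.1 hzt
    have h3 : (adjGraph G').dist (c z) (c t) ≤ 1 := by
      obtain h | ⟨e', he', h4, h5⟩ := hc e he z h1 t h2
      · simp [h]
      · exact dist_le_one_of_mem he' h4 h5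
    have := (hc.reachable (h x z)).dist_triangle_left (c t)
    show (adjGraph G').dist (c x) (c t) ≤ (adjGraph G').dist (c x) (c z) + 1
    omega

/-! ### Gate maps: a local criterion for acyclicity -/

/-- `c` is a gate map of the edge `e`: it is injective on `e` and constant on every other edge.
The fibres of `c` then separate the branches of `G` hanging at different vertices of `e`. -/
def IsGate (G : Hypergraph V) (e : Set V) (c : V → V) : Prop :=
  Set.InjOn c e ∧ ∀ e' ∈ G.edgeSet, e' ≠ e → ∀ x ∈ e', ∀ y ∈ e', c x = c y

lemma not_hasCycle_of_forall_exists_isGate {G : Hypergraph V}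
    (h : ∀ e ∈ G.edgeSet, ∃ c, IsGate G e c) : ¬ HasCycle G := by
  rintro ⟨l, v, e, hv, he, hve⟩
  obtain ⟨c, hc1, hc2⟩ := h (e 0) (hve 0).1
  -- going round the cycle, `c` does not change along the edges `e 1, e 2, …`
  have key : ∀ n : ℕ, 1 ≤ n → n ≤ l + 2 → c (v (Fin.ofNat (l + 2) n)) = c (v 1) := by
    intro n hn
    induction n, hn using Nat.le_induction with
    | base => intro _; rfl
    | succ n hn ih =>
      intro hn'
      rw [← ih (by omega)]
      have hne : Fin.ofNat (l + 2) n ≠ 0 := by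
        intro h0
        have := congrArg Fin.val h0
        rw [Fin.val_ofNat, Nat.mod_eq_of_lt (by omega), Fin.val_zero] at this
        omega
      have hsucc : Fin.ofNat (l + 2) (n + 1) = Fin.ofNat (l + 2) n + 1 := by
        ext
        simp [Fin.val_add]
      obtain ⟨h1, h2, h3⟩ := hve (Fin.ofNat (l + 2) n)
      rw [hsucc]
      exact hc2 _ h1 (fun h => hne (he h)) _ h3 _ h2
  have h1 := key (l + 2) (by omega) le_rfl
  have h0 : Fin.ofNat (l + 2) (l + 2) = 0 := by
    ext
    simp
  rw [h0] at h1
  have h2 := hv (hc1 (hve 0).2.1 (by simpa using (hve 0).2.2) h1)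
  simp at h2

/-- In an acyclic hypergraph distinct vertices of `e` lie in different components after `e` is
removed: a geodesic joining two of them in the rest of `G` would be closed to a cycle by `e`. -/
lemma exists_isGate {G : Hypergraph V} (h : ¬ HasCycle G) {e : Set V} (he : e ∈ G.edgeSet) :
    ∃ c, IsGate G e c := by
  -- `H` is the graph of the hypergraph without `e`, and `c` picks a vertex of each component
  let H : SimpleGraph V :=
    SimpleGraph.fromRel fun x y => ∃ e' ∈ G.edgeSet, e' ≠ e ∧ x ∈ e' ∧ y ∈ e'
  have hH : ∀ x y, H.Adj x y ↔ x ≠ y ∧ ∃ e' ∈ G.edgeSet, e' ≠ e ∧ x ∈ e' ∧ y ∈ e' := by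
    intro x y
    rw [SimpleGraph.fromRel_adj]
    constructor
    · rintro ⟨h, ⟨e, he, h1, h2, h3⟩ | ⟨e, he, h1, h2, h3⟩⟩
      exacts [⟨h, e, he, h1, h2, h3⟩, ⟨h, e, he, h1, h3, h2⟩]
    · rintro ⟨h, e, he, h1, h2, h3⟩
      exact ⟨h, Or.inl ⟨e, he, h1, h2, h3⟩⟩
  refine ⟨fun x => (H.connectedComponentMk x).out, ?_, ?_⟩
  · intro x hx y hy hxy
    by_contra hne
    have hr : H.Reachable x y := by
      have : H.connectedComponentMk x = H.connectedComponentMk y := by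
        rw [← Quot.out_eq (H.connectedComponentMk x), ← Quot.out_eq (H.connectedComponentMk y)]
        exact congrArg _ hxy
      exact SimpleGraph.ConnectedComponent.exact this
    obtain ⟨p, hp0, hpn, hadj, hdist⟩ := hr.exists_geodesic
    obtain ⟨l, hl⟩ : ∃ l, H.dist x y = l + 1 :=
      Nat.exists_eq_add_of_lt (by simpa using hr.pos_dist_of_ne hne) |>.imp fun l hl => by omega
    rw [hl] at hpn hadj hdist
    choose g hg1 hg2 hg3 hg4 using fun i hi => ((hH _ _).1 (hadj i hi)).2
    have hlt : ∀ i (hi : i < l + 1) j (hj : j < l + 1), i < j → g i hi ≠ g j hj := by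
      intro i hi j hj hij heq
      have h1 := hdist i (j + 1) (by omega) (by omega)
      have h2 : H.dist (p i) (p (j + 1)) = 1 := by
        refine SimpleGraph.dist_eq_one_iff_adj.2
          ((hH _ _).2 ⟨?_, g i hi, hg1 i hi, hg2 i hi, hg3 i hi, heq ▸ hg4 j hj⟩)
        intro h3
        rw [h3, SimpleGraph.dist_self] at h1
        omega
      omega
    refine h ⟨l, fun i => p i, fun i => if hi : (i : ℕ) < l + 1 then g i hi else e, ?_, ?_, ?_⟩
    · have hlt' : ∀ i j : Fin (l + 2), i < j → p i ≠ p j := by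
        intro i j hij heq
        have h1 := hdist i j (by omega) (by omega)
        rw [heq, SimpleGraph.dist_self] at h1
        omega
      intro i j hij
      rcases lt_trichotomy i j with h | h | h
      exacts [absurd hij (hlt' _ _ h), h, absurd hij.symm (hlt' _ _ h)]
    · intro i j hij
      dsimp only at hij
      split_ifs at hij with h1 h2 h2
      · rcases lt_trichotomy (i : ℕ) j with h | h | h
        exacts [absurd hij (hlt _ _ _ _ h), Fin.ext h, absurd hij.symm (hlt _ _ _ _ h)]
      · exact absurd hij (hg2 _ _)
      · exact absurd hij.symm (hg2 _ _)
      · exact Fin.ext (by omega)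
    · intro i
      dsimp only
      split_ifs with hi
      · have : ((i + 1 : Fin (l + 2)) : ℕ) = i + 1 := by
          rw [Fin.val_add, Fin.val_one, Nat.mod_eq_of_lt (by omega)]
        rw [this]
        exact ⟨hg1 _ _, hg3 _ _, hg4 _ _⟩
      · have hi' : i = Fin.last (l + 1) := Fin.ext (by rw [Fin.val_last]; omega)
        subst hi'
        refine ⟨he, ?_, ?_⟩
        · rw [Fin.val_last, hpn]; exact hy
        · rw [Fin.last_add_one, Fin.val_zero, hp0]; exact hx
  · intro e' he' hne x hx y hy
    by_cases hxy : x = y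
    · rw [hxy]
    · have : H.connectedComponentMk x = H.connectedComponentMk y :=
        SimpleGraph.ConnectedComponent.sound ((hH _ _).2 ⟨hxy, e', he', hne, hx, hy⟩).reachable
      dsimp only
      rw [this]

/-- Two edges of an acyclic hypergraph share at most one vertex. -/
lemma eq_of_mem_of_mem {G : Hypergraph V} (h : ¬ HasCycle G) {e e' : Set V} (he : e ∈ G.edgeSet)
    (he' : e' ∈ G.edgeSet) (hne : e ≠ e') {x y : V} (hx : x ∈ e) (hx' : x ∈ e') (hy : y ∈ e)
    (hy' : y ∈ e') : x = y := by
  obtain ⟨c, h1, h2⟩ := exists_isGate h he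
  exact h1 hx hy (h2 e' he' hne.symm x hx' y hy')

/-! ### The shift of the edges at one vertex to another -/

open scoped Classical in
/-- The edge `e` moved from `u` to `w`: the vertex `u` is replaced by `w` if `e` contains `u` but
not `w`, and `e` is left alone otherwise. -/
def moveEdge (u w : V) (e : Set V) : Set V :=
  if u ∈ e ∧ w ∉ e then Equiv.swap u w '' e else e

/-- The hypergraph on all of `V` obtained by moving every edge of `G` from `u` to `w`. -/
def shift (u w : V) (G : Hypergraph V) : Hypergraph V where
  vertexSet := Set.univ
  edgeSet := moveEdge u w '' G.edgeSet
  subset_vertexSet_of_mem_edgeSet' _ _ := Set.subset_univ _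

lemma moveEdge_of_mem {u w : V} {e : Set V} (hw : w ∈ e) : moveEdge u w e = e := by
  simp [moveEdge, hw]

lemma moveEdge_of_notMem {u w : V} {e : Set V} (hu : u ∉ e) : moveEdge u w e = e := by
  simp [moveEdge, hu]

lemma moveEdge_of_mem_of_notMem {u w : V} {e : Set V} (hu : u ∈ e) (hw : w ∉ e) :
    moveEdge u w e = insert w (e \ {u}) := by
  classical
  rw [moveEdge, if_pos ⟨hu, hw⟩]
  ext x
  rw [Equiv.image_eq_preimage_symm, Set.mem_preimage, Equiv.symm_swap, Equiv.swap_apply_def]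
  have huw : u ≠ w := fun h => hw (h ▸ hu)
  split_ifs with h1 h2
  · subst h1; simp [hw, huw]
  · subst h2; simp [hu]
  · simp [h1, h2]

open scoped Classical in
/-- Exchanging the roles of `u` and `w` in the shift amounts to renaming the vertices. -/
lemma image_swap_moveEdge (u w : V) (e : Set V) :
    Equiv.swap u w '' moveEdge u w e = moveEdge w u e := by
  have hid : u ∈ e → w ∈ e → Equiv.swap u w '' e = e := by
    intro hu hw
    ext x
    rw [Equiv.image_eq_preimage_symm, Set.mem_preimage, Equiv.symm_swap, Equiv.swap_apply_def]
    split_ifs with h1 h2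
    · subst h1; simp [hu, hw]
    · subst h2; simp [hu, hw]
    · rfl
  have hid' : u ∉ e → w ∉ e → Equiv.swap u w '' e = e := by
    intro hu hw
    ext x
    rw [Equiv.image_eq_preimage_symm, Set.mem_preimage, Equiv.symm_swap, Equiv.swap_apply_def]
    split_ifs with h1 h2
    · subst h1; simp [hu, hw]
    · subst h2; simp [hu, hw]
    · rfl
  by_cases hu : u ∈ e <;> by_cases hw : w ∈ e
  · rw [moveEdge_of_mem hw, moveEdge_of_mem hu, hid hu hw]
  · rw [moveEdge_of_notMem hw, moveEdge, if_pos ⟨hu, hw⟩, ← Set.image_comp]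
    have : ⇑(Equiv.swap u w) ∘ ⇑(Equiv.swap u w) = id := by
      funext x
      exact Equiv.swap_apply_self u w x
    rw [this, Set.image_id]
  · rw [moveEdge_of_notMem hu, moveEdge, if_pos ⟨hw, hu⟩, Equiv.swap_comm]
  · rw [moveEdge_of_notMem hu, moveEdge_of_notMem hw, hid' hu hw]

lemma ncard_moveEdge (u w : V) (e : Set V) : (moveEdge u w e).ncard = e.ncard := by
  classical
  rw [moveEdge]
  split_ifs
  · exact Set.ncard_image_of_injective _ (Equiv.injective _)
  · rfl

lemma IsUniform.shift {G : Hypergraph V} {k : ℕ} (hG : IsUniform k G) (u w : V) :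
    IsUniform k (shift u w G) := by
  refine ⟨rfl, ?_⟩
  rintro _ ⟨e, he, rfl⟩
  rw [ncard_moveEdge, hG.2 e he]

lemma moveEdge_injOn {G : Hypergraph V} {k : ℕ} (hk : 3 ≤ k) (hG : IsUniform k G)
    (hac : ¬ HasCycle G) (u w : V) : Set.InjOn (moveEdge u w) G.edgeSet := by
  classical
  -- a moved edge keeps at least two vertices, so it is not another edge of `G`
  have key : ∀ e ∈ G.edgeSet, ∀ e' ∈ G.edgeSet, (u ∈ e ∧ w ∉ e) →
      moveEdge u w e = e' → e = e' := by
    rintro e he e' he' ⟨hu, hw⟩ h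
    by_contra hne
    rw [moveEdge_of_mem_of_notMem hu hw] at h
    have h3 : 2 < e.ncard := by rw [hG.2 e he]; omega
    obtain ⟨x, y, hx, hy, hxu, hyu, hxy⟩ : ∃ x y, x ∈ e ∧ y ∈ e ∧ x ≠ u ∧ y ≠ u ∧ x ≠ y := by
      obtain ⟨p, q, r, hp, hq, hr, h1, h2, h3⟩ :=
        (Set.two_lt_ncard_iff (Set.finite_of_ncard_ne_zero (by omega))).1 h3
      grind
    refine hxy (eq_of_mem_of_mem hac he he' hne hx ?_ hy ?_)
    · rw [← h]; exact Or.inr ⟨hx, hxu⟩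
    · rw [← h]; exact Or.inr ⟨hy, hyu⟩
  intro e he e' he' h
  by_cases h1 : u ∈ e ∧ w ∉ e <;> by_cases h2 : u ∈ e' ∧ w ∉ e'
  · rw [moveEdge, moveEdge, if_pos h1, if_pos h2] at h
    exact Set.image_injective.2 (Equiv.injective _) h
  · refine key e he e' he' h1 (h.trans ?_)
    rw [moveEdge, if_neg h2]
  · refine (key e' he' e he h2 (h.symm.trans ?_)).symm
    rw [moveEdge, if_neg h1]
  · rwa [moveEdge, moveEdge, if_neg h1, if_neg h2] at h

section ShiftInEdge

variable {G : Hypergraph V} {f : Set V} {u w : V}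

/-- Moving all edges but `f` from `u` to another vertex `w` of the edge `f` creates no cycle:
gate maps survive, where for `f` itself the branches at `u` are reassigned to `w`. -/
lemma not_hasCycle_shift (hac : ¬ HasCycle G) (hf : f ∈ G.edgeSet) (hu : u ∈ f) (hw : w ∈ f)
    (huw : u ≠ w) : ¬ HasCycle (shift u w G) := by
  classical
  refine not_hasCycle_of_forall_exists_isGate ?_
  rintro _ ⟨e, he, rfl⟩
  obtain ⟨c, hc1, hc2⟩ := exists_isGate hac he
  have hfe : ∀ e ∈ G.edgeSet, u ∈ e → w ∈ e → e = f := fun e he h1 h2 => by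
    by_contra hne
    exact huw (eq_of_mem_of_mem hac he hf hne h1 hu h2 hw)
  by_cases hef : e = f
  · subst hef
    have hcuw : c u ≠ c w := fun h => huw (hc1 hu hw h)
    refine ⟨fun x => if c x = c u ∧ x ≠ u then c w else c x, ?_, ?_⟩
    · rw [moveEdge_of_mem hw]
      intro x hx y hy hxy
      have h1 : ∀ z ∈ e, ¬ (c z = c u ∧ z ≠ u) := fun z hz h => h.2 (hc1 hz hu h.1)
      dsimp only at hxy
      rw [if_neg (h1 x hx), if_neg (h1 y hy)] at hxy
      exact hc1 hx hy hxy
    · rintro _ ⟨e', he', rfl⟩ hne x hx y hy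
      have hne' : e' ≠ e := fun h => hne (by rw [h])
      have hconst := hc2 e' he' hne'
      dsimp only
      by_cases hue : u ∈ e'
      · have hwe : w ∉ e' := fun h => hne' (hfe e' he' hue h)
        rw [moveEdge_of_mem_of_notMem hue hwe] at hx hy
        have h1 : ∀ z ∈ insert w (e' \ {u}), (if c z = c u ∧ z ≠ u then c w else c z) = c w := by
          rintro z (rfl | ⟨hz, hzu⟩)
          · simp
          · rw [if_pos ⟨hconst z hz u hue, hzu⟩]
        rw [h1 x hx, h1 y hy]
      · rw [moveEdge_of_notMem hue] at hx hy
        have hxu : x ≠ u := fun h => hue (h ▸ hx)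
        have hyu : y ≠ u := fun h => hue (h ▸ hy)
        simp only [hconst x hx y hy, ne_eq, hxu, hyu]
  · have hcuw : c u = c w := hc2 f hf (Ne.symm hef) u hu w hw
    refine ⟨c, ?_, ?_⟩
    · by_cases hue : u ∈ e
      · have hwe : w ∉ e := fun h => hef (hfe e he hue h)
        rw [moveEdge_of_mem_of_notMem hue hwe]
        rintro x (rfl | ⟨hx, hxu⟩) y (rfl | ⟨hy, hyu⟩) hxy
        · rfl
        · exact absurd (hc1 hy hue (hxy.symm.trans hcuw.symm)) hyu
        · exact absurd (hc1 hx hue (hxy.trans hcuw.symm)) hxu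
        · exact hc1 hx hy hxy
      · rwa [moveEdge_of_notMem hue]
    · rintro _ ⟨e', he', rfl⟩ hne x hx y hy
      have hne' : e' ≠ e := fun h => hne (by rw [h])
      have hconst := hc2 e' he' hne'
      by_cases hmv : u ∈ e' ∧ w ∉ e'
      · rw [moveEdge_of_mem_of_notMem hmv.1 hmv.2] at hx hy
        have h1 : ∀ z ∈ insert w (e' \ {u}), c z = c u := by
          rintro z (rfl | ⟨hz, -⟩)
          · exact hcuw.symm
          · exact hconst z hz u hmv.1
        rw [h1 x hx, h1 y hy]
      · rw [moveEdge, if_neg hmv] at hx hy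
        exact hconst x hx y hy

open scoped Classical in
lemma isContraction_shift (G : Hypergraph V) (u w : V) :
    IsContraction G (shift u w G) fun x => if x = u then w else x := by
  intro e he x hx y hy
  refine Or.inr ⟨moveEdge u w e, ⟨e, he, rfl⟩, ?_⟩
  have h1 : ∀ z ∈ e, (if z = u then w else z) ∈ moveEdge u w e := by
    intro z hz
    by_cases hu : u ∈ e
    · by_cases hw : w ∈ e
      · rw [moveEdge_of_mem hw]
        split_ifs
        exacts [hw, hz]
      · rw [moveEdge_of_mem_of_notMem hu hw]
        split_ifs with h
        exacts [Or.inl rfl, Or.inr ⟨hz, h⟩]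
    · rw [moveEdge_of_notMem hu, if_neg (by rintro rfl; exact hu hz)]
      exact hz
  exact ⟨h1 x hx, h1 y hy⟩

lemma connected_shift (hconn : (adjGraph G).Connected) (hf : f ∈ G.edgeSet) (hu : u ∈ f)
    (hw : w ∈ f) (huw : u ≠ w) : (adjGraph (shift u w G)).Connected := by
  classical
  have hwx : ∀ x, (adjGraph (shift u w G)).Reachable w x := by
    intro x
    by_cases hx : x = u
    · rw [hx]
      have hf' : f ∈ (shift u w G).edgeSet := ⟨f, hf, moveEdge_of_mem hw⟩
      exact (adjGraph_adj.2 ⟨huw.symm, f, hf', hw, hu⟩).reachable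
    · have := (isContraction_shift G u w).reachable (hconn w x)
      simpa [hx, huw.symm] using this
  exact (SimpleGraph.connected_iff_exists_forall_reachable _).2 ⟨w, hwx⟩

open scoped Classical in
/-- Collapsing the branches at `u` to `u` maps `G` to its shift. -/
lemma IsGate.isContraction_collapse {c : V → V} (hc : IsGate G f c) (hf : f ∈ G.edgeSet)
    (hu : u ∈ f) (hw : w ∈ f) :
    IsContraction G (shift u w G) fun x => if c x = c u then u else x := by
  intro e he x hx y hy
  by_cases hef : e = f
  · subst hef
    refine Or.inr ⟨e, ⟨e, hf, moveEdge_of_mem hw⟩, ?_, ?_⟩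
    · dsimp only
      split_ifs
      exacts [hu, hx]
    · dsimp only
      split_ifs
      exacts [hu, hy]
  · have hconst := hc.2 e he hef
    dsimp only
    rw [← hconst x hx y hy]
    split_ifs with h
    · exact Or.inl rfl
    · refine Or.inr ⟨e, ⟨e, he, moveEdge_of_notMem fun hue => h (hconst x hx u hue)⟩, hx, hy⟩

open scoped Classical in
/-- Collapsing the moved branches to `w` maps the shift of `G` to `G`. -/
lemma IsGate.isContraction_collapse_shift {c : V → V} (hc : IsGate G f c) (hf : f ∈ G.edgeSet)
    (hu : u ∈ f) (hw : w ∈ f) (huw : u ≠ w) :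
    IsContraction (shift u w G) G fun x => if c x = c u then w else x := by
  rintro _ ⟨e, he, rfl⟩ x hx y hy
  by_cases hef : e = f
  · subst hef
    rw [moveEdge_of_mem hw] at hx hy
    refine Or.inr ⟨e, hf, ?_, ?_⟩
    · dsimp only
      split_ifs
      exacts [hw, hx]
    · dsimp only
      split_ifs
      exacts [hw, hy]
  · have hconst := hc.2 e he hef
    dsimp only
    by_cases hmv : u ∈ e ∧ w ∉ e
    · rw [moveEdge_of_mem_of_notMem hmv.1 hmv.2] at hx hy
      have h1 : ∀ z ∈ insert w (e \ {u}), (if c z = c u then w else z) = w := by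
        rintro z (rfl | ⟨hz, -⟩)
        · simp
        · rw [if_pos (hconst z hz u hmv.1)]
      rw [h1 x hx, h1 y hy]
      exact Or.inl rfl
    · rw [moveEdge, if_neg hmv] at hx hy
      rw [← hconst x hx y hy]
      split_ifs
      · exact Or.inl rfl
      · exact Or.inr ⟨e, he, hx, hy⟩

/-- A vertex in a branch at `u` is farther from `w` than from `u`. -/
lemma IsGate.dist_add_one_le {c : V → V} (hc : IsGate G f c) (hconn : (adjGraph G).Connected)
    (hu : u ∈ f) (hw : w ∈ f) (huw : u ≠ w) {y : V} (hy : c y = c u) :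
    (adjGraph G).dist u y + 1 ≤ (adjGraph G).dist w y := by
  classical
  have := (hconn w y).le_add_dist
    (ℓ := fun z => if c z = c u then (adjGraph G).dist u z + 1 else 0) ?_
  · have hwu : c w ≠ c u := fun h => huw (hc.1 hu hw h.symm)
    simpa [hy, hwu] using this
  · intro x z hxz
    obtain ⟨-, e, he, hx, hz⟩ := adjGraph_adj.1 hxz
    by_cases hef : e = f
    · subst hef
      split_ifs with h1 h2 h2
      · rw [hc.1 hz hu h1, SimpleGraph.dist_self]; omega
      · rw [hc.1 hz hu h1, SimpleGraph.dist_self]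
      · omega
      · omega
    · rw [hc.2 e he hef z hz x hx]
      have h3 := dist_le_one_of_mem he hx hz
      have h4 := hconn.dist_triangle (u := u) (v := x) (w := z)
      split_ifs <;> omega

/-- If the ends of a diametral path lie outside the branches at `u`, the shift from `u` to another
vertex `w` of `f` keeps the diameter. -/
lemma diam_shift [Finite V] {c : V → V} (hc : IsGate G f c)
    (hconn : (adjGraph G).Connected) (hf : f ∈ G.edgeSet) (hu : u ∈ f) (hw : w ∈ f) (huw : u ≠ w)
    {a b : V} (hab : (adjGraph G).dist a b = (adjGraph G).diam) (ha : c a ≠ c u)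
    (hb : c b ≠ c u) : (adjGraph (shift u w G)).diam = (adjGraph G).diam := by
  classical
  have hne : Nonempty V := ⟨u⟩
  have hconn' := connected_shift hconn hf hu hw huw
  have htop := SimpleGraph.connected_iff_ediam_ne_top.1 hconn
  have htop' := SimpleGraph.connected_iff_ediam_ne_top.1 hconn'
  have hf' : f ∈ (shift u w G).edgeSet := ⟨f, hf, moveEdge_of_mem hw⟩
  have hdu : ∀ y, (adjGraph (shift u w G)).dist u y ≤ (adjGraph G).diam := by
    intro y
    by_cases hy : c y = c u
    · by_cases hyu : y = u
      · simp [hyu]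
      · have h1 := (isContraction_shift G u w).dist_le (x := u) (y := y) hconn
        simp only [if_true, if_neg hyu] at h1
        have h2 := hconn'.dist_triangle (u := u) (v := w) (w := y)
        have h3 := dist_le_one_of_mem hf' hu hw
        have h4 := hc.dist_add_one_le hconn hu hw huw hy
        have h5 := SimpleGraph.dist_le_diam htop (u := w) (v := y)
        omega
    · have h1 := (hc.isContraction_collapse hf hu hw).dist_le (x := u) (y := y) hconn
      simp only [if_true, if_neg hy] at h1
      exact h1.trans (SimpleGraph.dist_le_diam htop)
  apply le_antisymm
  · obtain ⟨x, y, hxy⟩ := (adjGraph (shift u w G)).exists_dist_eq_diam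
    rw [← hxy]
    by_cases hx : x = u
    · rw [hx]; exact hdu y
    by_cases hy : y = u
    · rw [hy, SimpleGraph.dist_comm]; exact hdu x
    have h1 := (isContraction_shift G u w).dist_le (x := x) (y := y) hconn
    simp only [if_neg hx, if_neg hy] at h1
    exact h1.trans (SimpleGraph.dist_le_diam htop)
  · have h1 := (hc.isContraction_collapse_shift hf hu hw huw).dist_le (x := a) (y := b) hconn'
    simp only [if_neg ha, if_neg hb] at h1
    rw [← hab]
    exact h1.trans (SimpleGraph.dist_le_diam htop')

end ShiftInEdge

/-! ### Supertrees that are not caterpillars -/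

lemma degree_ne_one_of_mem_of_mem {G : Hypergraph V} {v : V} {e e' : Set V} (he : e ∈ G.edgeSet)
    (he' : e' ∈ G.edgeSet) (hne : e ≠ e') (h : v ∈ e) (h' : v ∈ e') : degree G v ≠ 1 := by
  intro h1
  obtain ⟨g, hg⟩ := Set.ncard_eq_one.1 h1
  have h2 : e ∈ ({g} : Set (Set V)) := hg ▸ ⟨he, h⟩
  have h3 : e' ∈ ({g} : Set (Set V)) := hg ▸ ⟨he', h'⟩
  exact hne (h2.trans h3.symm)

lemma exists_ne_edge_of_degree_ne_one {G : Hypergraph V} {v : V} {f : Set V} (hf : f ∈ G.edgeSet)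
    (hv : v ∈ f) (h : degree G v ≠ 1) : ∃ e ∈ G.edgeSet, e ≠ f ∧ v ∈ e := by
  by_contra! hcon
  refine h (Set.ncard_eq_one.2 ⟨f, ?_⟩)
  ext e
  constructor
  · rintro ⟨he, hve⟩
    by_contra hne
    exact hcon e he hne hve
  · rintro rfl
    exact ⟨hf, hv⟩

/-- If every edge that is not pendant separates `a` from `b`, then the edges that are not
pendant form a loose path: they all lie on a geodesic from `a` to `b`, and every edge of the
geodesic except possibly the first and the last one is not pendant. -/
lemma isLoosePath_of_forall_separates {G : Hypergraph V} (hG : IsSupertree G) (a b : V)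
    (h : ∀ f ∈ G.edgeSet, ¬ IsPendantEdge G f → ∀ c, IsGate G f c → c a ≠ c b) :
    IsLoosePath {e | e ∈ G.edgeSet ∧ ¬ IsPendantEdge G e} := by
  classical
  obtain ⟨hconn, hac⟩ := hG
  obtain ⟨p, hp0, hpn, hadj, hdist⟩ := (hconn a b).exists_geodesic
  set n := (adjGraph G).dist a b with hn
  choose! g hgE hg hg' using fun i hi => (adjGraph_adj.1 (hadj i hi)).2
  have hdisj : ∀ i j, i + 1 < j → j < n → g i ∩ g j = ∅ := by
    intro i j hij hj
    by_contra hne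
    obtain ⟨z, hz1, hz2⟩ := Set.nonempty_iff_ne_empty.2 hne
    have h1 := hdist i (j + 1) (by omega) (by omega)
    have h2 := hconn.dist_triangle (u := p i) (v := z) (w := p (j + 1))
    have h3 := dist_le_one_of_mem (hgE i (by omega)) (hg i (by omega)) hz1
    have h4 := dist_le_one_of_mem (hgE j hj) hz2 (hg' j hj)
    omega
  have hsucc : ∀ i, i + 1 < n → g i ≠ g (i + 1) := by
    intro i hi heq
    have h1 := hdist i (i + 1 + 1) (by omega) (by omega)
    have h2 := dist_le_one_of_mem (hgE i (by omega)) (hg i (by omega))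
      (heq ▸ hg' (i + 1) hi)
    omega
  have hlt : ∀ i j, i < j → j < n → g i ≠ g j := by
    intro i j hij hj heq
    obtain h1 | rfl := (Nat.succ_le_of_lt hij).lt_or_eq
    · have h2 := hdisj i j h1 hj
      rw [heq, Set.inter_self] at h2
      exact (h2 ▸ hg j hj : p j ∈ (∅ : Set V))
    · exact hsucc i hj heq
  have hmem : ∀ f ∈ G.edgeSet, ¬ IsPendantEdge G f → ∃ i < n, g i = f := by
    intro f hf hnp
    by_contra! hcon
    obtain ⟨c, hc⟩ := exists_isGate hac hf
    have key : ∀ i ≤ n, c a = c (p i) := by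
      intro i
      induction i with
      | zero => intro _; rw [hp0]
      | succ i ih =>
        intro hi
        rw [ih (by omega)]
        exact hc.2 (g i) (hgE i hi) (hcon i hi) _ (hg i hi) _ (hg' i hi)
    exact h f hf hnp c hc (by rw [key n le_rfl, hpn])
  have hinner : ∀ i, 0 < i → i + 1 < n → ¬ IsPendantEdge G (g i) := by
    rintro i hi hin ⟨-, hsub⟩
    obtain ⟨i, rfl⟩ := Nat.exists_eq_succ_of_ne_zero hi.ne'
    have h1 : p (i + 1) = p (i + 1 + 1) := by
      refine hsub ⟨hg _ (by omega), ?_⟩ ⟨hg' _ (by omega), ?_⟩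
      · exact degree_ne_one_of_mem_of_mem (hgE i (by omega)) (hgE (i + 1) (by omega))
          (hsucc i (by omega)) (hg' i (by omega)) (hg (i + 1) (by omega))
      · exact degree_ne_one_of_mem_of_mem (hgE (i + 1) (by omega)) (hgE (i + 1 + 1) hin)
          (hsucc (i + 1) hin) (hg' (i + 1) (by omega)) (hg (i + 1 + 1) hin)
    exact (hadj (i + 1) (by omega)).ne h1
  -- the edges that are not pendant are `g s, …, g (t - 1)`: only `g 0` and `g (n - 1)` may be pendant
  obtain ⟨s, t, htn, hst⟩ : ∃ s t, t ≤ n ∧ ∀ i < n, ¬ IsPendantEdge G (g i) ↔ s ≤ i ∧ i < t := by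
    refine ⟨if IsPendantEdge G (g 0) then 1 else 0,
      if IsPendantEdge G (g (n - 1)) then n - 1 else n, by split_ifs <;> omega, ?_⟩
    intro i hi
    by_cases hi0 : i = 0
    · subst hi0
      by_cases hn1 : n = 1
      · rw [hn1]; split_ifs with h1 <;> simp_all
      · by_cases h1 : IsPendantEdge G (g 0)
        · simp [h1]
        · simp only [h1, not_false_eq_true, if_false, le_refl, true_and, true_iff]
          split_ifs <;> omega
    · by_cases hin : i = n - 1
      · subst hin
        by_cases h1 : IsPendantEdge G (g (n - 1))
        · simp [h1]
        · simp only [h1, not_false_eq_true, if_false, true_iff]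
          split_ifs <;> omega
      · have := hinner i (by omega) (by omega)
        simp only [this, not_false_eq_true, true_iff]
        split_ifs <;> omega
  refine ⟨t - s, fun j => g (s + j), ?_, ?_, ?_⟩
  · intro i j hij
    rcases lt_trichotomy i j with h | h | h
    · exact absurd hij (hlt _ _ (by omega) (by omega))
    · exact h
    · exact absurd hij.symm (hlt _ _ (by omega) (by omega))
  · ext f
    constructor
    · rintro ⟨j, rfl⟩
      exact ⟨hgE _ (by omega), (hst _ (by omega)).2 ⟨by omega, by omega⟩⟩
    · rintro ⟨hf, hnp⟩
      obtain ⟨i, hi, rfl⟩ := hmem f hf hnp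
      obtain ⟨h1, h2⟩ := (hst i hi).1 hnp
      exact ⟨⟨i - s, by omega⟩, by simp [Nat.add_sub_cancel' h1]⟩
  · intro i j hij
    have hj := j.2
    split_ifs with h1
    · have h2 : g (s + i) ∩ g (s + j) = {p (s + j)} := by
        refine Set.eq_singleton_iff_unique_mem.2 ⟨⟨?_, hg _ (by omega)⟩, ?_⟩
        · rw [← h1, ← add_assoc]; exact hg' _ (by omega)
        · rintro z ⟨hz1, hz2⟩
          refine eq_of_mem_of_mem hac (hgE (s + i) (by omega)) (hgE (s + j) (by omega))
            (hlt _ _ (by omega) (by omega)) hz1 hz2 ?_ (hg _ (by omega))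
          rw [← h1, ← add_assoc]; exact hg' _ (by omega)
      show (g (s + i) ∩ g (s + j)).encard = 1
      rw [h2, Set.encard_singleton]
    · show (g (s + i) ∩ g (s + j)).encard = 0
      rw [hdisj _ _ (by omega) (by omega), Set.encard_empty]

/-- A supertree that is not a caterpillar has an edge `f` with two vertices `u`, `w` of degree at
least two such that the ends `a`, `b` of some diametral path lie outside the branches at `u`. -/
lemma IsNonCaterpillar.exists_branch {G : Hypergraph V} (hG : IsNonCaterpillar G) :
    ∃ f ∈ G.edgeSet, ∃ u ∈ f, ∃ w ∈ f, u ≠ w ∧ (∃ e ∈ G.edgeSet, e ≠ f ∧ u ∈ e) ∧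
      (∃ e ∈ G.edgeSet, e ≠ f ∧ w ∈ e) ∧ ∃ c, IsGate G f c ∧ ∃ a b,
        (adjGraph G).dist a b = (adjGraph G).diam ∧ c a ≠ c u ∧ c b ≠ c u := by
  obtain ⟨hst, hncat⟩ := hG
  have := hst.1.nonempty
  obtain ⟨a, b, hab⟩ := (adjGraph G).exists_dist_eq_diam
  by_contra! hcon
  refine hncat ⟨hst, isLoosePath_of_forall_separates hst a b ?_⟩
  intro f hf hnp c hc hcab
  have h1 : ¬ {v | v ∈ f ∧ degree G v ≠ 1}.Subsingleton := fun h => hnp ⟨hf, h⟩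
  obtain ⟨u, ⟨hu, hdu⟩, w, ⟨hw, hdw⟩, huw⟩ := Set.not_subsingleton_iff.1 h1
  have hu' := exists_ne_edge_of_degree_ne_one hf hu hdu
  have hw' := exists_ne_edge_of_degree_ne_one hf hw hdw
  have key : ∀ x ∈ f, ∀ y ∈ f, x ≠ y → (∃ e ∈ G.edgeSet, e ≠ f ∧ x ∈ e) →
      (∃ e ∈ G.edgeSet, e ≠ f ∧ y ∈ e) → c a = c x := by
    intro x hx y hy hxy hx' hy'
    by_contra h
    exact h (hcab.trans (hcon f hf x hx y hy hxy hx' hy' c hc a b hab h))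
  exact huw (hc.1 hu hw ((key u hu w hw huw hu' hw').symm.trans
    (key w hw u hu huw.symm hw' hu')))

end Combinatorics
section Spectral

open scoped Classical

variable {V : Type*} [Fintype V]

/-! ### The polynomial form of the tensor -/

/-- The vertices of an edge, as a finset. -/
def vertFinset (e : Set V) : Finset V := {v | v ∈ e}

/-- The edges of a hypergraph, as a finset. -/
def edgeFinset (G : Hypergraph V) : Finset (Set V) := {e | e ∈ G.edgeSet}

@[simp] lemma mem_vertFinset {e : Set V} {v : V} : v ∈ vertFinset e ↔ v ∈ e := by
  simp [vertFinset]

@[simp] lemma mem_edgeFinset {G : Hypergraph V} {e : Set V} :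
    e ∈ edgeFinset G ↔ e ∈ G.edgeSet := by
  simp [edgeFinset]

lemma card_vertFinset (e : Set V) : (vertFinset e).card = e.ncard := by
  rw [← Set.ncard_coe_finset]
  congr 1
  ext
  simp

lemma IsUniform.card_vertFinset {G : Hypergraph V} {k : ℕ} (hG : IsUniform k G) {e : Set V}
    (he : e ∈ G.edgeSet) : (vertFinset e).card = k := by
  rw [AlphaSpectral.card_vertFinset, hG.2 e he]

/-- The contribution of the edge `e` to the form `x ↦ ∑_v x_v (𝒜_α x)_v`. -/
def edgeForm (k : ℕ) (α : ℝ) (e : Set V) (x : V → ℝ) : ℝ :=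
  α * ∑ v ∈ vertFinset e, x v ^ k + (1 - α) * k * ∏ v ∈ vertFinset e, x v

/-- The form `x ↦ ∑_v x_v (𝒜_α x)_v`, written as a sum over the edges. -/
def form (k : ℕ) (α : ℝ) (G : Hypergraph V) (x : V → ℝ) : ℝ :=
  ∑ e ∈ edgeFinset G, edgeForm k α e x

/-- The vector `𝒜_α x`, written as a sum over the edges at `v`; over `ℝ` this is the gradient of
`form`, up to the factor `k`. -/
def edgeApply {𝕜 : Type*} [CommRing 𝕜] [Algebra ℝ 𝕜] (k : ℕ) (α : ℝ) (G : Hypergraph V)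
    (x : V → 𝕜) (v : V) : 𝕜 :=
  ∑ e ∈ edgeFinset G with v ∈ e,
    (α • x v ^ (k - 1) + (1 - α) • ∏ u ∈ (vertFinset e).erase v, x u)

lemma sum_prod_of_range_eq {n : ℕ} {T : Set V} (hT : T.ncard = n) (z : V → ℂ) :
    ∑ g : Fin n → V with Set.range g = T, ∏ j, z (g j) =
      n.factorial * ∏ u ∈ vertFinset T, z u := by
  have hcardT : Fintype.card T = n := by
    rw [← hT, Set.ncard_eq_toFinset_card', Set.toFinset_card]
  have hbij : ∀ g : Fin n → V, ∀ hg : Set.range g = T,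
      Function.Bijective (fun j => (⟨g j, hg ▸ Set.mem_range_self j⟩ : T)) := by
    intro g hg
    rw [Fintype.bijective_iff_surjective_and_card]
    refine ⟨?_, by simp [hcardT]⟩
    rintro ⟨t, ht⟩
    obtain ⟨j, hj⟩ := hg.symm ▸ ht
    exact ⟨j, Subtype.ext hj⟩
  let E : {g : Fin n → V // Set.range g = T} ≃ (Fin n ≃ T) :=
    { toFun := fun g => Equiv.ofBijective _ (hbij g.1 g.2)
      invFun := fun σ => ⟨fun j => σ j, by
        ext t
        constructor
        · rintro ⟨j, rfl⟩
          exact (σ j).2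
        · intro ht
          exact ⟨σ.symm ⟨t, ht⟩, by simp⟩⟩
      left_inv := fun g => rfl
      right_inv := fun σ => by ext; rfl }
  have hcard : (Finset.univ.filter fun g : Fin n → V => Set.range g = T).card = n.factorial := by
    rw [← Fintype.card_subtype, Fintype.card_congr E,
      Fintype.card_equiv (Fintype.equivOfCardEq (by simp [hcardT]) : Fin n ≃ T), Fintype.card_fin]
  have hprod : ∀ g ∈ Finset.univ.filter fun g : Fin n → V => Set.range g = T,
      ∏ j, z (g j) = ∏ u ∈ vertFinset T, z u := by
    intro g hg
    have hg' : Set.range g = T := by simpa using hg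
    refine Finset.prod_bij (fun j _ => g j) ?_ ?_ ?_ ?_
    · intro j _
      rw [mem_vertFinset, ← hg']
      exact Set.mem_range_self j
    · intro i _ j _ hij
      exact (hbij g hg').1 (Subtype.ext hij)
    · intro t ht
      rw [mem_vertFinset, ← hg'] at ht
      obtain ⟨j, hj⟩ := ht
      exact ⟨j, Finset.mem_univ _, hj⟩
    · intro j _
      rfl
  rw [Finset.sum_congr rfl hprod, Finset.sum_const, hcard, nsmul_eq_mul]

lemma sum_prod_of_insert_range_eq {n : ℕ} {v : V} {e : Set V} (he : e.ncard = n + 1)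
    (hv : v ∈ e) (z : V → ℂ) :
    ∑ g : Fin n → V with insert v (Set.range g) = e, ∏ j, z (g j) =
      n.factorial * ∏ u ∈ (vertFinset e).erase v, z u := by
  have hT : (e \ {v}).ncard = n := by
    rw [Set.ncard_sdiff_singleton_of_mem hv, he]
    rfl
  have h1 : vertFinset (e \ {v}) = (vertFinset e).erase v := by
    ext u
    simp [and_comm]
  rw [← h1, ← sum_prod_of_range_eq hT z]
  refine Finset.sum_congr (Finset.filter_congr fun g _ => ?_) fun _ _ => rfl
  constructor
  · intro h
    -- `range g` has at most `n` elements and contains the `n` elements of `e \ {v}`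
    refine (Set.eq_of_subset_of_ncard_le ?_ ?_ (Set.toFinite _)).symm
    · rintro u ⟨hu, huv⟩
      rw [← h] at hu
      exact hu.resolve_left huv
    · rw [hT, ← Set.image_univ]
      exact (Set.ncard_image_le (Set.toFinite _)).trans (by simp [Set.ncard_univ])
  · intro h
    rw [h, Set.insert_sdiff_singleton, Set.insert_eq_of_mem hv]

lemma apply_eq_sum_cons {n : ℕ} (A : Tensor (n + 1) V) (z : V → ℂ) (v : V) :
    A.apply z v = ∑ g : Fin n → V, (A (Fin.cons v g) : ℂ) * ∏ j, z (g j) := by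
  unfold Tensor.apply
  refine Finset.sum_bij' (fun i _ => Fin.tail i) (fun g _ => Fin.cons v g) ?_ ?_ ?_ ?_ ?_
  · intro i _
    exact Finset.mem_univ _
  · intro g _
    rw [Finset.mem_filter]
    refine ⟨Finset.mem_univ _, fun j hj => ?_⟩
    have : j = 0 := Fin.ext hj
    rw [this, Fin.cons_zero]
  · intro i hi
    have : i 0 = v := (Finset.mem_filter.1 hi).2 0 rfl
    rw [← this, Fin.cons_self_tail]
  · intro g _
    exact Fin.tail_cons _ _
  · intro i hi
    have : i 0 = v := (Finset.mem_filter.1 hi).2 0 rfl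
    rw [← this, Fin.cons_self_tail]
    congr 1
    rw [Finset.prod_filter, Fin.prod_univ_succ]
    simp [Fin.tail]

/-- The tensor `𝒜_α(G)` acts on vectors as the sum over the edges `edgeApply`: each edge at `v`
comes from `(k - 1)!` multi-indices. -/
lemma apply_alphaTensor {k : ℕ} (hk : k ≠ 0) (α : ℝ) {G : Hypergraph V} (hG : IsUniform k G)
    (z : V → ℂ) (v : V) : (alphaTensor k α G).apply z v = edgeApply k α G z v := by
  obtain ⟨n, rfl⟩ := Nat.exists_eq_succ_of_ne_zero hk
  rw [apply_eq_sum_cons]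
  have hdeg : ∀ g : Fin n → V, degreeTensor (n + 1) G (Fin.cons v g) =
      if g = fun _ => v then (degree G v : ℝ) else 0 := by
    intro g
    have h1 : ∀ w : V, (Fin.cons v g : Fin (n + 1) → V) = (fun _ => w) ↔
        w = v ∧ g = fun _ => v := by
      intro w
      constructor
      · intro h
        have h0 : v = w := by simpa using congrFun h 0
        refine ⟨h0.symm, funext fun j => ?_⟩
        have := congrFun h j.succ
        rw [Fin.cons_succ] at this
        rw [this, h0]
      · rintro ⟨rfl, rfl⟩
        funext j
        refine Fin.cases ?_ (fun _ => ?_) j <;> simp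
    unfold degreeTensor
    simp only [h1]
    by_cases hg : g = fun _ => v <;> simp [hg]
  have hadj : ∀ g : Fin n → V, adjacencyTensor (n + 1) G (Fin.cons v g) =
      if insert v (Set.range g) ∈ G.edgeSet then 1 / (n.factorial : ℝ) else 0 := by
    intro g
    unfold adjacencyTensor
    rw [Fin.range_cons]
    rfl
  have hdegree : degree G v = ((edgeFinset G).filter fun e => v ∈ e).card := by
    rw [degree, ← Set.ncard_coe_finset]
    congr 1
    ext e
    simp
  have h1 : ∑ g : Fin n → V, ((if g = fun _ => v then (degree G v : ℝ) else 0 : ℝ) : ℂ) *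
      ∏ j, z (g j) = degree G v * z v ^ n := by
    rw [Finset.sum_eq_single fun _ => v]
    · simp
    · intro g _ hg
      simp [hg]
    · simp
  have h2 : ∑ g : Fin n → V, ((if insert v (Set.range g) ∈ G.edgeSet then
      1 / (n.factorial : ℝ) else 0 : ℝ) : ℂ) * ∏ j, z (g j) =
      ∑ e ∈ edgeFinset G with v ∈ e, ∏ u ∈ (vertFinset e).erase v, z u := by
    have h3 : ∀ g : Fin n → V, ((if insert v (Set.range g) ∈ G.edgeSet then
        1 / (n.factorial : ℝ) else 0 : ℝ) : ℂ) * ∏ j, z (g j) =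
        if insert v (Set.range g) ∈ G.edgeSet then
          1 / (n.factorial : ℂ) * ∏ j, z (g j) else 0 := by
      intro g
      split_ifs <;> simp
    rw [Finset.sum_congr rfl fun g _ => h3 g, ← Finset.sum_filter, ← Finset.mul_sum]
    rw [← Finset.sum_fiberwise_of_maps_to
      (t := (edgeFinset G).filter fun e => v ∈ e) (g := fun g => insert v (Set.range g))]
    · rw [Finset.mul_sum]
      refine Finset.sum_congr rfl fun e he => ?_
      rw [Finset.mem_filter, mem_edgeFinset] at he
      have h4 : ((Finset.univ.filter fun g : Fin n → V => insert v (Set.range g) ∈ G.edgeSet).filter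
          fun g => insert v (Set.range g) = e) =
          Finset.univ.filter fun g : Fin n → V => insert v (Set.range g) = e := by
        ext g
        simp only [Finset.mem_filter, Finset.mem_univ, true_and, and_iff_right_iff_imp]
        intro h
        rw [h]
        exact he.1
      rw [h4, sum_prod_of_insert_range_eq (hG.2 e he.1) he.2, ← mul_assoc, one_div,
        inv_mul_cancel₀ (by exact_mod_cast n.factorial_ne_zero), one_mul]
    · intro g hg
      simpa using hg
  simp only [alphaTensor, hdeg, hadj]
  have h5 : ∀ g : Fin n → V, ((α * (if g = fun _ => v then (degree G v : ℝ) else 0) +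
      (1 - α) * (if insert v (Set.range g) ∈ G.edgeSet then 1 / (n.factorial : ℝ) else 0) : ℝ) : ℂ)
        * ∏ j, z (g j) =
      α * (((if g = fun _ => v then (degree G v : ℝ) else 0 : ℝ) : ℂ) * ∏ j, z (g j)) +
      (1 - α) * (((if insert v (Set.range g) ∈ G.edgeSet then
        1 / (n.factorial : ℝ) else 0 : ℝ) : ℂ) * ∏ j, z (g j)) := by
    intro g
    rw [Complex.ofReal_add, Complex.ofReal_mul, Complex.ofReal_mul, Complex.ofReal_sub,
      Complex.ofReal_one]
    ring
  rw [Finset.sum_congr rfl fun g _ => h5 g, Finset.sum_add_distrib, ← Finset.mul_sum,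
    ← Finset.mul_sum, h1, h2, hdegree, edgeApply, Finset.sum_add_distrib, Finset.sum_const,
    ← Finset.smul_sum]
  simp only [nsmul_eq_mul, Complex.real_smul, Nat.succ_eq_add_one, Nat.add_sub_cancel]
  push_cast
  ring

lemma sum_mul_edgeApply {k : ℕ} (hk : k ≠ 0) (α : ℝ) {G : Hypergraph V} (hG : IsUniform k G)
    (x : V → ℝ) : ∑ v, x v * edgeApply k α G x v = form k α G x := by
  simp only [edgeApply, Finset.mul_sum, Finset.sum_filter]
  rw [Finset.sum_comm]
  refine Finset.sum_congr rfl fun e he => ?_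
  have h1 : ∀ v ∈ vertFinset e, x v * (α • x v ^ (k - 1) +
      (1 - α) • ∏ u ∈ (vertFinset e).erase v, x u) =
      α * x v ^ k + (1 - α) * ∏ u ∈ vertFinset e, x u := by
    intro v hv
    rw [← Finset.mul_prod_erase _ _ hv, smul_eq_mul, smul_eq_mul,
      ← mul_pow_sub_one hk (x v)]
    ring
  have h2 : ∑ v, (x v * if v ∈ e then α • x v ^ (k - 1) +
      (1 - α) • ∏ u ∈ (vertFinset e).erase v, x u else 0) =
      ∑ v ∈ vertFinset e, x v * (α • x v ^ (k - 1) +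
        (1 - α) • ∏ u ∈ (vertFinset e).erase v, x u) := by
    rw [vertFinset, Finset.sum_filter]
    exact Finset.sum_congr rfl fun v _ => by split_ifs <;> simp
  have h3 : ∑ v, x v * (if v ∈ e then α • x v ^ (k - 1) +
      (1 - α) • ∏ u ∈ (vertFinset e).erase v, x u else 0) = edgeForm k α e x := by
    rw [h2, Finset.sum_congr rfl h1, Finset.sum_add_distrib, ← Finset.mul_sum, Finset.sum_const,
      hG.card_vertFinset (mem_edgeFinset.1 he), edgeForm, nsmul_eq_mul]
    ring
  rw [← h3]

lemma form_smul {k : ℕ} (α : ℝ) {G : Hypergraph V} (hG : IsUniform k G) (c : ℝ) (x : V → ℝ) :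
    form k α G (fun v => c * x v) = c ^ k * form k α G x := by
  unfold form
  rw [Finset.mul_sum]
  refine Finset.sum_congr rfl fun e he => ?_
  simp only [edgeForm, mul_pow, Finset.prod_mul_distrib, Finset.prod_const,
    hG.card_vertFinset (mem_edgeFinset.1 he), ← Finset.mul_sum]
  ring

lemma continuous_form (k : ℕ) (α : ℝ) (G : Hypergraph V) : Continuous (form k α G) := by
  unfold form edgeForm
  fun_prop

lemma edgeForm_nonneg (k : ℕ) {α : ℝ} (hα0 : 0 ≤ α) (hα1 : α < 1) (e : Set V) {x : V → ℝ}
    (hx : ∀ v, 0 ≤ x v) : 0 ≤ edgeForm k α e x := by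
  have h1 : 0 ≤ 1 - α := by linarith
  have h2 : 0 ≤ ∑ v ∈ vertFinset e, x v ^ k := Finset.sum_nonneg fun v _ => pow_nonneg (hx v) k
  have h3 : 0 ≤ ∏ v ∈ vertFinset e, x v := Finset.prod_nonneg fun v _ => hx v
  unfold edgeForm
  positivity

lemma edgeForm_mono (k : ℕ) {α : ℝ} (hα0 : 0 ≤ α) (hα1 : α < 1) (e : Set V) {x y : V → ℝ}
    (hx : ∀ v, 0 ≤ x v) (hxy : ∀ v ∈ e, x v ≤ y v) : edgeForm k α e x ≤ edgeForm k α e y := by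
  have h1 : 0 ≤ 1 - α := by linarith
  have h2 : ∑ v ∈ vertFinset e, x v ^ k ≤ ∑ v ∈ vertFinset e, y v ^ k :=
    Finset.sum_le_sum fun v hv => pow_le_pow_left₀ (hx v) (hxy v (mem_vertFinset.1 hv)) k
  have h3 : ∏ v ∈ vertFinset e, x v ≤ ∏ v ∈ vertFinset e, y v :=
    Finset.prod_le_prod (fun v _ => hx v) fun v hv => hxy v (mem_vertFinset.1 hv)
  unfold edgeForm
  gcongr

/-! ### Maximizers of the form are Perron vectors -/

/-- `r` bounds the quotient of `form k α G y` by `∑ v, y v ^ k` over the nonnegative vectors. -/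
def IsFormBound (k : ℕ) (α : ℝ) (G : Hypergraph V) (r : ℝ) : Prop :=
  ∀ y : V → ℝ, (∀ v, 0 ≤ y v) → form k α G y ≤ r * ∑ v, y v ^ k

lemma exists_form_maximizer [Nonempty V] {k : ℕ} (hk : k ≠ 0) (α : ℝ) {G : Hypergraph V}
    (hG : IsUniform k G) :
    ∃ x : V → ℝ, (∀ v, 0 ≤ x v) ∧ ∑ v, x v ^ k = 1 ∧ IsFormBound k α G (form k α G x) := by
  let K : Set (V → ℝ) := {x | (∀ v, 0 ≤ x v) ∧ ∑ v, x v ^ k = 1}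
  have hK : IsCompact K := by
    refine (isCompact_Icc (a := (0 : V → ℝ)) (b := 1)).of_isClosed_subset ?_ ?_
    · refine IsClosed.inter ?_ ?_
      · exact isClosed_Ici (a := (0 : V → ℝ))
      · exact isClosed_eq (by fun_prop) continuous_const
    · rintro x ⟨hx0, hx1⟩
      refine ⟨fun v => hx0 v, fun v => ?_⟩
      have h1 : x v ^ k ≤ 1 := by
        rw [← hx1]
        exact Finset.single_le_sum (f := fun v => x v ^ k) (fun v _ => pow_nonneg (hx0 v) k)
          (Finset.mem_univ v)
      exact (pow_le_one_iff_of_nonneg (hx0 v) hk).1 h1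
  have hne : K.Nonempty := by
    obtain ⟨v₀⟩ := ‹Nonempty V›
    refine ⟨Pi.single v₀ 1, fun v => ?_, ?_⟩
    · by_cases h : v = v₀
      · subst h; simp
      · simp [h]
    · rw [Finset.sum_eq_single v₀]
      · simp
      · intro v _ h
        simp [h, hk]
      · simp
  obtain ⟨x, ⟨hx0, hx1⟩, hmax⟩ := hK.exists_isMaxOn hne (continuous_form k α G).continuousOn
  refine ⟨x, hx0, hx1, fun y hy => ?_⟩
  have hN0 : 0 ≤ ∑ v, y v ^ k := Finset.sum_nonneg fun v _ => pow_nonneg (hy v) k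
  obtain hN | hN := hN0.eq_or_lt
  · have hy0 : y = fun v => 0 * y v := by
      funext v
      have := (Finset.sum_eq_zero_iff_of_nonneg fun v _ => pow_nonneg (hy v) k).1 hN.symm v
        (Finset.mem_univ v)
      rw [zero_mul]
      exact (pow_eq_zero_iff hk).1 this
    rw [← hN, mul_zero, hy0, form_smul α hG, zero_pow hk, zero_mul]
  · -- rescale `y` by the `k`-th root of `∑ v, y v ^ k`
    obtain ⟨c, hc0, hc⟩ : ∃ c : ℝ, 0 < c ∧ c ^ k = ∑ v, y v ^ k :=
      ⟨(∑ v, y v ^ k) ^ ((k : ℝ)⁻¹), Real.rpow_pos_of_pos hN _,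
        Real.rpow_inv_natCast_pow hN.le hk⟩
    have h1 : form k α G (fun v => c⁻¹ * y v) ≤ form k α G x := by
      refine hmax ⟨fun v => mul_nonneg (inv_nonneg.2 hc0.le) (hy v), ?_⟩
      simp only [mul_pow, ← Finset.mul_sum]
      rw [← hc, ← mul_pow, inv_mul_cancel₀ hc0.ne', one_pow]
    rw [form_smul α hG, inv_pow, inv_mul_le_iff₀ (pow_pos hc0 k), hc] at h1
    linarith

/-- A maximizer is positive on an edge as soon as it is positive at one of its vertices: otherwise
raising all coordinates to at least `ε` gains the order `ε ^ (k - 1)` on that edge and costs only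
the order `ε ^ k`. -/
lemma pos_of_mem_edge_of_pos {k : ℕ} (hk : k ≠ 0) {α : ℝ} (hα0 : 0 ≤ α) (hα1 : α < 1)
    {G : Hypergraph V} (hG : IsUniform k G) {x : V → ℝ} (hx0 : ∀ v, 0 ≤ x v)
    (hx1 : ∑ v, x v ^ k = 1) (hmax : IsFormBound k α G (form k α G x)) {e : Set V}
    (he : e ∈ G.edgeSet) {a b : V} (ha : a ∈ e) (hb : b ∈ e) (hxa : 0 < x a) : 0 < x b := by
  by_contra hxb
  have hxb : x b = 0 := le_antisymm (not_lt.1 hxb) (hx0 b)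
  set r := form k α G x with hr
  have hr0 : 0 ≤ r := Finset.sum_nonneg fun e _ => edgeForm_nonneg k hα0 hα1 e hx0
  have hα : 0 < 1 - α := by linarith
  have hk' : (0 : ℝ) < k := by exact_mod_cast Nat.pos_of_ne_zero hk
  have key : ∀ ε : ℝ, 0 < ε → (1 - α) * k * x a ≤ r * Fintype.card V * ε := by
    intro ε hε
    let y : V → ℝ := fun v => max (x v) ε
    have hxy : ∀ v, x v ≤ y v := fun v => le_max_left _ _
    have h1 : edgeForm k α e x + (1 - α) * k * (x a * ε ^ (k - 1)) ≤ edgeForm k α e y := by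
      have h2 : ∏ v ∈ vertFinset e, x v = 0 :=
        Finset.prod_eq_zero (mem_vertFinset.2 hb) hxb
      have h3 : x a * ε ^ (k - 1) ≤ ∏ v ∈ vertFinset e, y v := by
        rw [← Finset.mul_prod_erase _ _ (mem_vertFinset.2 ha)]
        have h4 : ((vertFinset e).erase a).card = k - 1 := by
          rw [Finset.card_erase_of_mem (mem_vertFinset.2 ha), hG.card_vertFinset he]
        refine mul_le_mul (hxy a) ?_ (pow_nonneg hε.le _) ((hx0 a).trans (hxy a))
        rw [← h4, ← Finset.prod_const]
        exact Finset.prod_le_prod (fun _ _ => hε.le) fun v _ => le_max_right _ _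
      have h5 : ∑ v ∈ vertFinset e, x v ^ k ≤ ∑ v ∈ vertFinset e, y v ^ k :=
        Finset.sum_le_sum fun v _ => pow_le_pow_left₀ (hx0 v) (hxy v) k
      unfold edgeForm
      rw [h2, mul_zero, add_zero]
      gcongr
    have h2 : r + (1 - α) * k * (x a * ε ^ (k - 1)) ≤ form k α G y := by
      rw [hr, form, form, ← Finset.add_sum_erase _ _ (mem_edgeFinset.2 he),
        ← Finset.add_sum_erase _ (fun e => edgeForm k α e y) (mem_edgeFinset.2 he)]
      have h3 : ∑ e ∈ (edgeFinset G).erase e, edgeForm k α e x ≤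
          ∑ e ∈ (edgeFinset G).erase e, edgeForm k α e y :=
        Finset.sum_le_sum fun e _ => edgeForm_mono k hα0 hα1 e hx0 fun v _ => hxy v
      linarith
    have h3 : ∑ v, y v ^ k ≤ 1 + Fintype.card V * ε ^ k := by
      have h4 : ∀ v ∈ Finset.univ, y v ^ k ≤ x v ^ k + ε ^ k := by
        intro v _
        rcases max_choice (x v) ε with h | h
        · simp only [y, h]
          linarith [pow_nonneg hε.le k]
        · simp only [y, h]
          linarith [pow_nonneg (hx0 v) k]
      refine (Finset.sum_le_sum h4).trans ?_
      rw [Finset.sum_add_distrib, hx1, Finset.sum_const, nsmul_eq_mul, Finset.card_univ]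
    have h4 := hmax y fun v => (hx0 v).trans (hxy v)
    have h5 : r * ∑ v, y v ^ k ≤ r * (1 + Fintype.card V * ε ^ k) := by gcongr
    rw [← mul_pow_sub_one hk ε] at h5
    have h6 : (1 - α) * k * x a * ε ^ (k - 1) ≤ r * Fintype.card V * ε * ε ^ (k - 1) := by
      nlinarith
    exact le_of_mul_le_mul_right h6 (pow_pos hε _)
  have h1 : 0 < (1 - α) * k * x a := by positivity
  have h2 : 0 ≤ r * Fintype.card V := by positivity
  have h3 := key ((1 - α) * k * x a / (r * Fintype.card V + 1)) (by positivity)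
  rw [← mul_div_assoc, le_div_iff₀ (by positivity)] at h3
  nlinarith

lemma pos_of_form_maximizer {k : ℕ} (hk : k ≠ 0) {α : ℝ} (hα0 : 0 ≤ α) (hα1 : α < 1)
    {G : Hypergraph V} (hG : IsUniform k G) (hconn : (adjGraph G).Connected) {x : V → ℝ}
    (hx0 : ∀ v, 0 ≤ x v) (hx1 : ∑ v, x v ^ k = 1) (hmax : IsFormBound k α G (form k α G x))
    (v : V) : 0 < x v := by
  obtain ⟨a, ha⟩ : ∃ a, 0 < x a := by
    by_contra! h
    have h0 : ∀ v, x v = 0 := fun v => le_antisymm (h v) (hx0 v)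
    simp [h0, hk] at hx1
  obtain ⟨p⟩ := hconn a v
  induction p with
  | nil => exact ha
  | cons hadj p ih =>
    obtain ⟨-, e, he, h1, h2⟩ := adjGraph_adj.1 hadj
    exact ih (pos_of_mem_edge_of_pos hk hα0 hα1 hG hx0 hx1 hmax he h1 h2 ha)

lemma hasDerivAt_form_update (k : ℕ) (α : ℝ) (G : Hypergraph V) (x : V → ℝ) (v : V) :
    HasDerivAt (fun s => form k α G (Function.update x v s)) (k * edgeApply k α G x v) (x v) := by
  have h1 : ∀ e ∈ edgeFinset G, HasDerivAt (fun s => edgeForm k α e (Function.update x v s))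
      (if v ∈ e then k * (α * x v ^ (k - 1) + (1 - α) * ∏ u ∈ (vertFinset e).erase v, x u) else 0)
      (x v) := by
    intro e _
    split_ifs with hv
    · have hv' := mem_vertFinset.2 hv
      have h2 : (fun s => edgeForm k α e (Function.update x v s)) = fun s =>
          α * (s ^ k + ∑ u ∈ (vertFinset e).erase v, x u ^ k) +
            (1 - α) * k * (s * ∏ u ∈ (vertFinset e).erase v, x u) := by
        funext s
        unfold edgeForm
        rw [← Finset.add_sum_erase _ _ hv', ← Finset.mul_prod_erase _ _ hv',
          Function.update_self]
        congr 3
        · exact Finset.sum_congr rfl fun u hu => by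
            rw [Function.update_of_ne (Finset.ne_of_mem_erase hu)]
        · exact Finset.prod_congr rfl fun u hu => by
            rw [Function.update_of_ne (Finset.ne_of_mem_erase hu)]
      rw [h2]
      refine ((((hasDerivAt_pow k (x v)).add_const _).const_mul α).add
        (((hasDerivAt_id (x v)).mul_const _).const_mul ((1 - α) * k))).congr_deriv ?_
      ring
    · have h2 : (fun s => edgeForm k α e (Function.update x v s)) = fun _ => edgeForm k α e x := by
        funext s
        have h3 : ∀ u ∈ vertFinset e, Function.update x v s u = x u := by
          intro u hu
          refine Function.update_of_ne ?_ _ _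
          rintro rfl
          exact hv (mem_vertFinset.1 hu)
        unfold edgeForm
        rw [Finset.prod_congr rfl h3, Finset.sum_congr rfl fun u hu => by rw [h3 u hu]]
      rw [h2]
      exact hasDerivAt_const _ _
  refine (HasDerivAt.fun_sum h1).congr_deriv ?_
  unfold edgeApply
  rw [Finset.sum_filter, Finset.mul_sum]
  exact Finset.sum_congr rfl fun e _ => by split_ifs <;> simp

/-- A positive maximizer is an eigenvector. -/
lemma edgeApply_eq_of_form_maximizer {k : ℕ} (hk : k ≠ 0) {α r : ℝ} {G : Hypergraph V}
    (hmax : IsFormBound k α G r) {x : V → ℝ} (hx : ∀ v, 0 < x v)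
    (hxr : form k α G x = r * ∑ v, x v ^ k) (v : V) :
    edgeApply k α G x v = r * x v ^ (k - 1) := by
  let φ : ℝ → ℝ := fun s => form k α G (Function.update x v s) -
    r * (s ^ k + ∑ u ∈ Finset.univ.erase v, x u ^ k)
  have hsum : ∀ s, ∑ u, Function.update x v s u ^ k =
      s ^ k + ∑ u ∈ Finset.univ.erase v, x u ^ k := by
    intro s
    rw [← Finset.add_sum_erase _ _ (Finset.mem_univ v), Function.update_self]
    congr 1
    exact Finset.sum_congr rfl fun u hu => by
      rw [Function.update_of_ne (Finset.ne_of_mem_erase hu)]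
  have hφ0 : φ (x v) = 0 := by
    simp only [φ]
    rw [← hsum, Function.update_eq_self, hxr, sub_self]
  have hloc : IsLocalMax φ (x v) := by
    filter_upwards [lt_mem_nhds (hx v)] with s hs
    rw [hφ0]
    simp only [φ]
    rw [← hsum, sub_nonpos]
    refine hmax _ fun u => ?_
    by_cases h : u = v
    · subst h; simpa using hs.le
    · simpa [h] using (hx u).le
  have hder : HasDerivAt φ (k * edgeApply k α G x v - r * (k * x v ^ (k - 1))) (x v) :=
    (hasDerivAt_form_update k α G x v).sub (((hasDerivAt_pow k (x v)).add_const _).const_mul r)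
  have h0 := hloc.hasDerivAt_eq_zero hder
  have hk' : (k : ℝ) ≠ 0 := by exact_mod_cast hk
  refine mul_left_cancel₀ hk' ?_
  linarith

lemma norm_le_of_isEigenvalue {k : ℕ} (hk : k ≠ 0) {α r : ℝ} (hα0 : 0 ≤ α) (hα1 : α < 1)
    {G : Hypergraph V} (hG : IsUniform k G) (hmax : IsFormBound k α G r) {μ : ℂ}
    (hμ : (alphaTensor k α G).IsEigenvalue μ) : ‖μ‖ ≤ r := by
  obtain ⟨z, hz, h⟩ := hμ
  have h1 : ∀ v, ‖edgeApply k α G z v‖ ≤ edgeApply k α G (fun v => ‖z v‖) v := by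
    intro v
    refine (norm_sum_le _ _).trans (Finset.sum_le_sum fun e _ => (norm_add_le _ _).trans ?_)
    rw [norm_smul, norm_smul, norm_pow, norm_prod, Real.norm_of_nonneg hα0,
      Real.norm_of_nonneg (by linarith : (0 : ℝ) ≤ 1 - α)]
    rfl
  have h2 : ∀ v ∈ Finset.univ, ‖μ‖ * ‖z v‖ ^ k ≤
      ‖z v‖ * edgeApply k α G (fun v => ‖z v‖) v := by
    intro v _
    have h3 := h1 v
    rw [← apply_alphaTensor hk α hG, h v, norm_mul, norm_pow] at h3
    have h4 := mul_le_mul_of_nonneg_left h3 (norm_nonneg (z v))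
    rw [← mul_pow_sub_one hk ‖z v‖]
    linarith
  have h3 := Finset.sum_le_sum h2
  rw [← Finset.mul_sum, sum_mul_edgeApply hk α hG] at h3
  have h4 := h3.trans (hmax _ fun v => norm_nonneg (z v))
  obtain ⟨v, hv⟩ := Function.ne_iff.1 hz
  have h5 : 0 < ∑ v, ‖z v‖ ^ k :=
    Finset.sum_pos' (fun v _ => by positivity) ⟨v, Finset.mem_univ v, by
      have := norm_pos_iff.2 hv
      positivity⟩
  exact le_of_mul_le_mul_right h4 h5

/-- The Perron–Frobenius theorem for `𝒜_α(G)`, `G` connected: the spectral radius is the maximum of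
the form over the nonnegative vectors with `∑ v, x v ^ k = 1`, and is attained by a positive one. -/
lemma exists_perron_vector {k : ℕ} (hk : k ≠ 0) {α : ℝ} (hα0 : 0 ≤ α) (hα1 : α < 1)
    {G : Hypergraph V} (hG : IsUniform k G) (hconn : (adjGraph G).Connected) :
    IsFormBound k α G (alphaSpectralRadius k α G) ∧ ∃ x : V → ℝ, (∀ v, 0 < x v) ∧
      form k α G x = alphaSpectralRadius k α G * ∑ v, x v ^ k := by
  have := hconn.nonempty
  obtain ⟨x, hx0, hx1, hmax⟩ := exists_form_maximizer hk α hG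
  have hpos := pos_of_form_maximizer hk hα0 hα1 hG hconn hx0 hx1 hmax
  have hr0 : 0 ≤ form k α G x := Finset.sum_nonneg fun e _ => edgeForm_nonneg k hα0 hα1 e hx0
  have heig : (alphaTensor k α G).IsEigenvalue (form k α G x : ℂ) := by
    refine ⟨fun v => (x v : ℂ), ?_, fun v => ?_⟩
    · obtain ⟨v⟩ := this
      intro h0
      have := congrFun h0 v
      exact (hpos v).ne' (by simpa using this)
    · have h1 := edgeApply_eq_of_form_maximizer hk hmax hpos (by rw [hx1, mul_one]) v
      rw [apply_alphaTensor hk α hG, ← Complex.ofReal_pow, ← Complex.ofReal_mul, ← h1]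
      unfold edgeApply
      push_cast
      simp [Complex.real_smul]
  have hρ : alphaSpectralRadius k α G = form k α G x := by
    refine IsGreatest.csSup_eq ⟨⟨_, heig, ?_⟩, ?_⟩
    · rw [Complex.norm_real, Real.norm_of_nonneg hr0]
    · rintro _ ⟨μ, hμ, rfl⟩
      exact norm_le_of_isEigenvalue hk hα0 hα1 hG hmax hμ
  rw [hρ]
  exact ⟨hmax, x, hpos, by rw [hx1, mul_one]⟩

/-! ### The shift increases the spectral radius -/

lemma edgeForm_image_equiv (k : ℕ) (α : ℝ) (σ : V ≃ V) (e : Set V) (x : V → ℝ) :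
    edgeForm k α (σ '' e) x = edgeForm k α e (x ∘ σ) := by
  have h1 : vertFinset (σ '' e) = (vertFinset e).map σ.toEmbedding := by
    ext v
    simp
  unfold edgeForm
  rw [h1, Finset.sum_map, Finset.prod_map]
  rfl

lemma form_shift {k : ℕ} (hk : 3 ≤ k) (α : ℝ) {G : Hypergraph V} (hG : IsUniform k G)
    (hac : ¬ HasCycle G) (u w : V) (x : V → ℝ) :
    form k α (shift u w G) x = ∑ e ∈ edgeFinset G, edgeForm k α (moveEdge u w e) x := by
  have h1 : edgeFinset (shift u w G) = (edgeFinset G).image (moveEdge u w) := by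
    ext e
    simp [shift]
  rw [form, h1, Finset.sum_image]
  intro e he e' he' h
  exact moveEdge_injOn hk hG hac u w (by simpa using he) (by simpa using he') h

lemma form_shift_comp_swap {k : ℕ} (hk : 3 ≤ k) (α : ℝ) {G : Hypergraph V} (hG : IsUniform k G)
    (hac : ¬ HasCycle G) (u w : V) (x : V → ℝ) :
    form k α (shift u w G) (x ∘ Equiv.swap u w) = form k α (shift w u G) x := by
  rw [form_shift hk α hG hac, form_shift hk α hG hac]
  refine Finset.sum_congr rfl fun e _ => ?_
  rw [← edgeForm_image_equiv, image_swap_moveEdge]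

section

variable {k : ℕ} {α : ℝ} {G : Hypergraph V} {f : Set V} {u w : V}

/-- The shifts in the two directions are isomorphic, so the roles of `u` and `w` can be exchanged
and this inequality is in fact an equality. -/
lemma alphaSpectralRadius_shift_le (hk : 3 ≤ k) (hα0 : 0 ≤ α) (hα1 : α < 1)
    (hG : IsUniform k G) (hst : IsSupertree G) (hf : f ∈ G.edgeSet) (hu : u ∈ f) (hw : w ∈ f)
    (huw : u ≠ w) :
    alphaSpectralRadius k α (shift w u G) ≤ alphaSpectralRadius k α (shift u w G) := by
  obtain ⟨-, x, hx, hxr⟩ := exists_perron_vector (by omega) hα0 hα1 (hG.shift w u)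
    (connected_shift hst.1 hf hw hu huw.symm)
  obtain ⟨hmax, -⟩ := exists_perron_vector (by omega) hα0 hα1 (hG.shift u w)
    (connected_shift hst.1 hf hu hw huw)
  have h1 := hmax (x ∘ Equiv.swap u w) fun v => (hx _).le
  rw [form_shift_comp_swap hk α hG hst.2, hxr] at h1
  have h2 : ∑ v, (x ∘ Equiv.swap u w) v ^ k = ∑ v, x v ^ k :=
    Equiv.sum_comp (Equiv.swap u w) fun v => x v ^ k
  rw [h2] at h1
  have : Nonempty V := ⟨u⟩
  exact le_of_mul_le_mul_right h1
    (Finset.sum_pos (fun v _ => pow_pos (hx v) k) Finset.univ_nonempty)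

/-- If the Perron vector is at least as large at `w` as at `u`, the shift from `u` to `w` does not
decrease the form, and it adds edges at `w`, which violates the eigenvalue equation at `w` if the
spectral radius stays the same. -/
lemma alphaSpectralRadius_lt_shift_of_le (hk : 3 ≤ k) (hα0 : 0 ≤ α) (hα1 : α < 1)
    (hG : IsUniform k G) (hst : IsSupertree G) (hf : f ∈ G.edgeSet) (hu : u ∈ f) (hw : w ∈ f)
    (huw : u ≠ w) (hue : ∃ e ∈ G.edgeSet, e ≠ f ∧ u ∈ e) {x : V → ℝ} (hx : ∀ v, 0 < x v)
    (hxr : form k α G x = alphaSpectralRadius k α G * ∑ v, x v ^ k) (hxuw : x u ≤ x w) :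
    alphaSpectralRadius k α G < alphaSpectralRadius k α (shift u w G) := by
  have hk0 : k ≠ 0 := by omega
  obtain ⟨hmax, -⟩ := exists_perron_vector hk0 hα0 hα1 hG hst.1
  obtain ⟨hmax', -⟩ := exists_perron_vector hk0 hα0 hα1 (hG.shift u w)
    (connected_shift hst.1 hf hu hw huw)
  have : Nonempty V := ⟨u⟩
  have hN : 0 < ∑ v, x v ^ k :=
    Finset.sum_pos (fun v _ => pow_pos (hx v) k) Finset.univ_nonempty
  have hle : form k α G x ≤ form k α (shift u w G) x := by
    rw [form_shift hk α hG hst.2]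
    refine Finset.sum_le_sum fun e _ => ?_
    rw [moveEdge]
    split_ifs with h
    · rw [edgeForm_image_equiv]
      refine edgeForm_mono k hα0 hα1 e (fun v => (hx v).le) fun v hv => ?_
      by_cases hvu : v = u
      · subst hvu
        simpa using hxuw
      · have hvw : v ≠ w := fun h' => h.2 (h' ▸ hv)
        rw [Function.comp_apply, Equiv.swap_apply_of_ne_of_ne hvu hvw]
    · exact le_rfl
  by_contra hcon
  have h1 := hmax' x fun v => (hx v).le
  have h2 : alphaSpectralRadius k α (shift u w G) * ∑ v, x v ^ k ≤
      alphaSpectralRadius k α G * ∑ v, x v ^ k :=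
    mul_le_mul_of_nonneg_right (not_lt.1 hcon) hN.le
  have heq : alphaSpectralRadius k α (shift u w G) = alphaSpectralRadius k α G :=
    mul_right_cancel₀ hN.ne' (le_antisymm h2 (by linarith))
  have h3 := edgeApply_eq_of_form_maximizer hk0 hmax hx hxr w
  have h4 := edgeApply_eq_of_form_maximizer hk0 hmax' hx (by linarith) w
  rw [heq, ← h3] at h4
  refine h4.not_gt ?_
  have hterm : ∀ e : Set V,
      0 < α • x w ^ (k - 1) + (1 - α) • ∏ v ∈ (vertFinset e).erase w, x v := by
    intro e
    have h5 : 0 < ∏ v ∈ (vertFinset e).erase w, x v := Finset.prod_pos fun v _ => hx v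
    have h6 : 0 < 1 - α := by linarith
    have h7 := pow_pos (hx w) (k - 1)
    rw [smul_eq_mul, smul_eq_mul]
    positivity
  obtain ⟨e, he, hef, hue⟩ := hue
  have hwe : w ∉ e := fun hwe => huw (eq_of_mem_of_mem hst.2 he hf hef hue hu hwe hw)
  have hmv := moveEdge_of_mem_of_notMem hue hwe
  -- the moved edge is not an edge of `G`, by injectivity of `moveEdge` on the edges
  have hnew : moveEdge u w e ∉ G.edgeSet := by
    intro hmem
    have h5 : moveEdge u w e = e := by
      refine moveEdge_injOn hk hG hst.2 u w hmem he ?_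
      rw [moveEdge_of_mem (hmv ▸ Set.mem_insert _ _)]
    exact hwe (h5 ▸ hmv ▸ Set.mem_insert _ _)
  refine Finset.sum_lt_sum_of_subset (i := moveEdge u w e) ?_ ?_ ?_ (hterm _)
    fun _ _ _ => (hterm _).le
  · intro e' he'
    rw [Finset.mem_filter, mem_edgeFinset] at he' ⊢
    exact ⟨⟨e', he'.1, moveEdge_of_mem he'.2⟩, he'.2⟩
  · rw [Finset.mem_filter, mem_edgeFinset]
    exact ⟨⟨e, he, rfl⟩, hmv ▸ Set.mem_insert _ _⟩
  · rw [Finset.mem_filter, mem_edgeFinset]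
    exact fun h => hnew h.1

/-- Moving the edges at `u` other than `f` to another vertex `w` of `f` increases the spectral
radius if both vertices have degree at least two. No comparison of the Perron vector at `u` and
`w` is needed, as the shifts in the two directions are isomorphic. -/
lemma alphaSpectralRadius_lt_shift (hk : 3 ≤ k) (hα0 : 0 ≤ α) (hα1 : α < 1)
    (hG : IsUniform k G) (hst : IsSupertree G) (hf : f ∈ G.edgeSet) (hu : u ∈ f) (hw : w ∈ f)
    (huw : u ≠ w) (hue : ∃ e ∈ G.edgeSet, e ≠ f ∧ u ∈ e)
    (hwe : ∃ e ∈ G.edgeSet, e ≠ f ∧ w ∈ e) :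
    alphaSpectralRadius k α G < alphaSpectralRadius k α (shift u w G) := by
  obtain ⟨-, x, hx, hxr⟩ := exists_perron_vector (by omega) hα0 hα1 hG hst.1
  obtain h | h := le_total (x u) (x w)
  · exact alphaSpectralRadius_lt_shift_of_le hk hα0 hα1 hG hst hf hu hw huw hue hx hxr h
  · exact (alphaSpectralRadius_lt_shift_of_le hk hα0 hα1 hG hst hf hw hu huw.symm hwe hx hxr
      h).trans_le (alphaSpectralRadius_shift_le hk hα0 hα1 hG hst hf hu hw huw)

end

/-- A supertree that is not a caterpillar does not maximize the spectral radius among the uniform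
supertrees with the same number of edges and the same diameter. -/
lemma exists_supertree_alphaSpectralRadius_lt {k : ℕ} (hk : 3 ≤ k) {α : ℝ} (hα0 : 0 ≤ α)
    (hα1 : α < 1) {G : Hypergraph V} (hG : IsUniform k G) (hnc : IsNonCaterpillar G) :
    ∃ G' : Hypergraph V, IsUniform k G' ∧ IsSupertree G' ∧
      G'.edgeSet.ncard = G.edgeSet.ncard ∧ (adjGraph G').diam = (adjGraph G).diam ∧
      alphaSpectralRadius k α G < alphaSpectralRadius k α G' := by
  obtain ⟨f, hf, u, hu, w, hw, huw, hue, hwe, c, hc, a, b, hab, ha, hb⟩ := hnc.exists_branch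
  have hst := hnc.1
  exact ⟨shift u w G, hG.shift u w,
    ⟨connected_shift hst.1 hf hu hw huw, not_hasCycle_shift hst.2 hf hu hw huw⟩,
    (moveEdge_injOn hk hG hst.2 u w).ncard_image,
    diam_shift hc hst.1 hf hu hw huw hab ha hb,
    alphaSpectralRadius_lt_shift hk hα0 hα1 hG hst hf hu hw huw hue hwe⟩

end Spectral

lemma finite_hypergraph (V : Type*) [Finite V] : Finite (Hypergraph V) :=
  Finite.of_injective (fun G : Hypergraph V => (G.vertexSet, G.edgeSet)) fun _ _ h =>
    Hypergraph.ext (congrArg Prod.fst h) (congrArg Prod.snd h)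

end AlphaSpectral

end

theorem mainTheorem7 {V : Type*} [Fintype V] (k m d : ℕ) (hk : 3 ≤ k)
    (α : ℝ) (hα0 : 0 ≤ α) (hα1 : α < 1)
    (G : Hypergraph V) (hG : G ∈ AlphaSpectral.nonCaterpillars V k m d) :
    ∃ G' ∈ AlphaSpectral.caterpillars V k m d,
      AlphaSpectral.alphaSpectralRadius k α G < AlphaSpectral.alphaSpectralRadius k α G' := by
  obtain ⟨hun, hnc, rfl, rfl⟩ := hG
  have := AlphaSpectral.finite_hypergraph V
  obtain ⟨G₁, h1, h2, h3, h4, hlt⟩ :=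
    AlphaSpectral.exists_supertree_alphaSpectralRadius_lt hk hα0 hα1 hun hnc
  -- a supertree of largest spectral radius with the given parameters has to be a caterpillar
  obtain ⟨G', ⟨h1', h2', h3', h4'⟩, hmax⟩ := Set.exists_max_image
    {H : Hypergraph V | AlphaSpectral.IsUniform k H ∧ AlphaSpectral.IsSupertree H ∧
      H.edgeSet.ncard = G.edgeSet.ncard ∧
      (AlphaSpectral.adjGraph H).diam = (AlphaSpectral.adjGraph G).diam}
    (AlphaSpectral.alphaSpectralRadius k α) (Set.toFinite _) ⟨G₁, h1, h2, h3, h4⟩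
  refine ⟨G', ⟨h1', ?_, h3', h4'⟩, hlt.trans_le (hmax G₁ ⟨h1, h2, h3, h4⟩)⟩
  by_contra hcat
  obtain ⟨G₂, g1, g2, g3, g4, hlt'⟩ :=
    AlphaSpectral.exists_supertree_alphaSpectralRadius_lt hk hα0 hα1 h1' ⟨h2', hcat⟩
  exact (hmax G₂ ⟨g1, g2, g3.trans h3', g4.trans h4'⟩).not_gt hlt'
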